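/- Setting. A connected undirected graph on $N\ge 1$ agents is given, with a mixing matrix $W=(w_{nm})\in[0,1]^{N\times N}$ that is doubly stochastic and satisfies $w_{nm}>0$ if $n=m$ or $n,m$ are neighbours, and $w_{nm}=0$ otherwise. Put $\lambda:=1-\|(I-\frac1N\mathbf 1\mathbf 1^\top)W\|^2$ (spectral norm), and assume $\lambda>0$. Agent $n$ has a data distribution $\mathcal D_n$; the samples $\xi_{n,z}\sim\mathcal D_n$ ($1\le n\le N$, $1\le z\le Z$, $Z\ge1$) are independent and form the dataset $\mathcal S$. For a loss $f(x;\xi)$, $x\in\mathbb R^d$, that is measurable and $\mathcal D_n$-integrable in $\xi$ for every $x$ and every $n$, let $$F(x)=\frac1N\sum_n\mathbb E_{\xi\sim\mathcal D_n}f(x;\xi),\qquad F_{\mathcal S_n}(x)=\frac1Z\sum_z f(x;\xi_{n,z}),\qquad F_{\mathcal S}(x)=\frac1N\sum_nF_{\mathcal S_n}(x),$$ and let $x^*_{\mathcal S}$ be the minimizer of $F_{\mathcal S}$. Algorithm (attack-free DSGD). All agents start at $x_n^0=x^0$. At time $k$ every agent draws $\xi_n^k$ uniformly from its local dataset $\{\xi_{n,1},\dots,\xi_{n,Z}\}$,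 independently of all other draws, and $x_n^{k+1}=\sum_m w_{nm}\bigl(x_m^k-\alpha^k\nabla f(x_m^k;\xi_m^k)\bigr)$. The output is $\bar x^k=\frac1N\sum_n x_n^k$ (so $\bar x^0=x^0$). Assumptions. (1) $f(\cdot;\xi)$ is $\mu$-strongly convex and (2) $L$-smooth for every $\xi$, with $\mu,L>0$. For almost every dataset $\mathcal S$ and all $x\in\mathbb R^d$: (3) $\frac1Z\sum_z\|\nabla f(x;\xi_{n,z})-\nabla F_{\mathcal S_n}(x)\|^2\le\sigma^2$ for every agent $n$; (4) $\frac1N\sum_n\|\nabla F_{\mathcal S_n}(x)-\nabla F_{\mathcal S}(x)\|^2\le\delta^2$. Moreover $\mathbb E_{\mathcal S}\|\bar x^0-x^*_{\mathcal S}\|^2<\infty$. Theorem (generalization error of attack-free DSGD with heterogeneous data). There is a threshold $\kappa$, depending only on $\mu,L,\lambda$, and for all $k_0>0$ and $b\in\mathbb R$, $a>0$ a constant $C>0$ depending only on $L,\lambda,k_0,a,b$, such that the following holds. If $k_0\ge\kappa$, the step sizes are $\alpha^t=\frac1{\mu(t+k_0)}$, and $k\asymp\mu NZ$ in the sense that $a\,\mu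 NZ\le k\le b\,\mu NZ$, then $F(\bar x^k)-F_{\mathcal S}(\bar x^k)$ is integrable and $$\mathbb E_{\mathcal S,\mathcal L}\bigl[F(\bar x^k)-F_{\mathcal S}(\bar x^k)\bigr]\le C\,\frac{\mathbb E_{\mathcal S}\|\bar x^0-x^*_{\mathcal S}\|^2}{\mu NZ}+C\,\frac{\sigma^2\,(1+\ln(NZ))}{\mu NZ}+C\,\frac{\delta^2}{\mu NZ},$$ where the expectation is over the dataset and over the draws of the algorithm. -/

import Mathlib

open MeasureTheory
open scoped BigOperators Gradient

noncomputable section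

namespace DSGD

/-- The model space `ℝ^d` with its Euclidean norm. -/
abbrev Model (d : ℕ) : Type := EuclideanSpace ℝ (Fin d)

/-- A global dataset: `S (n, z)` is the `z`-th training sample of agent `n`. -/
abbrev Dataset (N Z : ℕ) (Ξ : Type*) : Type _ := Fin N × Fin Z → Ξ

/-- First-order form of `μ`-strong convexity (`g` is assumed differentiable where this is used). -/
def StronglyConvex {d : ℕ} (μ : ℝ) (g : Model d → ℝ) : Prop :=
  ∀ x y : Model d, g y + inner ℝ (x - y) (∇ g y) + μ / 2 * ‖x - y‖ ^ 2 ≤ g x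

/-- `L`-smoothness: `g` is differentiable with an `L`-Lipschitz gradient. -/
def Smooth {d : ℕ} (L : ℝ) (g : Model d → ℝ) : Prop :=
  Differentiable ℝ g ∧ ∀ x y : Model d, ‖∇ g x - ∇ g y‖ ≤ L * ‖x - y‖

section Losses

variable {d N Z : ℕ} {Ξ : Type*}

/-- Population loss `F(x) = (1/N) ∑ₙ 𝔼_{ξ ∼ Dₙ} f(x; ξ)`. -/
def popLoss [MeasurableSpace Ξ] (f : Model d → Ξ → ℝ) (D : Fin N → Measure Ξ) (x : Model d) : ℝ :=
  (N : ℝ)⁻¹ * ∑ n, ∫ ξ, f x ξ ∂(D n)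

/-- Local empirical loss `F_{Sₙ}(x) = (1/Z) ∑_z f(x; ξ_{n,z})` of agent `n`. -/
def localLoss (f : Model d → Ξ → ℝ) (S : Dataset N Z Ξ) (n : Fin N) (x : Model d) : ℝ :=
  (Z : ℝ)⁻¹ * ∑ z, f x (S (n, z))

/-- Global empirical loss `F_S(x) = (1/N) ∑ₙ F_{Sₙ}(x)`. -/
def empLoss (f : Model d → Ξ → ℝ) (S : Dataset N Z Ξ) (x : Model d) : ℝ :=
  (N : ℝ)⁻¹ * ∑ n, localLoss f S n x

/-- The minimizer `x*_S` of the global empirical loss; it exists and is unique as soon as the loss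
is differentiable and strongly convex and `N, Z ≥ 1`. -/
def empMinimizer (f : Model d → Ξ → ℝ) (S : Dataset N Z Ξ) : Model d :=
  Classical.epsilon fun x => ∀ y, empLoss f S x ≤ empLoss f S y

/-- Stochastic gradient noise at most `σ²` on the dataset `S`: the variance of the gradient at one
sample drawn uniformly from the local dataset, at every point and for every agent. -/
def NoiseBound (f : Model d → Ξ → ℝ) (S : Dataset N Z Ξ) (σ : ℝ) : Prop :=
  ∀ (x : Model d) (n : Fin N),
    (Z : ℝ)⁻¹ * ∑ z, ‖∇ (fun y => f y (S (n, z))) x - ∇ (localLoss f S n) x‖ ^ 2 ≤ σ ^ 2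

/-- Heterogeneity at most `δ²` on the dataset `S`. -/
def HeterogeneityBound (f : Model d → Ξ → ℝ) (S : Dataset N Z Ξ) (δ : ℝ) : Prop :=
  ∀ x : Model d,
    (N : ℝ)⁻¹ * ∑ n, ‖∇ (localLoss f S n) x - ∇ (empLoss f S) x‖ ^ 2 ≤ δ ^ 2

/-- The law of the dataset: all samples are independent, and `ξ_{n,z} ∼ Dₙ`. -/
def dataLaw [MeasurableSpace Ξ] (Z : ℕ) (D : Fin N → Measure Ξ) : Measure (Dataset N Z Ξ) :=
  Measure.pi fun p : Fin N × Fin Z => D p.1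

end Losses

/-- `W` is a doubly stochastic mixing matrix supported exactly on the edges of the communication
graph and on the diagonal. -/
structure IsMixingMatrix {N : ℕ} (G : SimpleGraph (Fin N)) (W : Matrix (Fin N) (Fin N) ℝ) :
    Prop where
  mem_Icc : ∀ n m, W n m ∈ Set.Icc (0 : ℝ) 1
  row_sum : ∀ n, ∑ m, W n m = 1
  col_sum : ∀ m, ∑ n, W n m = 1
  pos : ∀ n m, G.Adj n m ∨ n = m → 0 < W n m
  zero : ∀ n m, ¬ (G.Adj n m ∨ n = m) → W n m = 0

/-- `λ = 1 - ‖(I - (1/N) 𝟏𝟏ᵀ) W‖²`, with the spectral norm. -/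
def spectralGap {N : ℕ} (W : Matrix (Fin N) (Fin N) ℝ) : ℝ :=
  1 - ‖Matrix.toEuclideanCLM (n := Fin N) (𝕜 := ℝ)
      ((1 - (N : ℝ)⁻¹ • Matrix.of fun _ _ => (1 : ℝ)) * W)‖ ^ 2

section Algorithm

variable {d N Z : ℕ} {Ξ : Type*}

/-- The local models after `k` steps of decentralized SGD on the dataset `S`, started at the common
point `x0`, with step sizes `α`. The argument `I` records the draws: at time `t < k`, agent `n`
uses the sample `S (n, I t n)`. One step is a local gradient step followed by averaging with `W`. -/
def localModels (f : Model d → Ξ → ℝ) (W : Matrix (Fin N) (Fin N) ℝ) (α : ℕ → ℝ)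
    (x0 : Model d) (S : Dataset N Z Ξ) :
    (k : ℕ) → (Fin k → Fin N → Fin Z) → Fin N → Model d
  | 0, _ => fun _ => x0
  | k + 1, I => fun n => ∑ m, W n m •
      (localModels f W α x0 S k (fun t => I t.castSucc) m
        - α k • ∇ (fun y => f y (S (m, I (Fin.last k) m)))
            (localModels f W α x0 S k (fun t => I t.castSucc) m))

/-- The output of the algorithm: the average of the local models after `k` steps. -/
def output (f : Model d → Ξ → ℝ) (W : Matrix (Fin N) (Fin N) ℝ) (α : ℕ → ℝ)
    (x0 : Model d) (S : Dataset N Z Ξ) (k : ℕ) (I : Fin k → Fin N → Fin Z) : Model d :=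
  (N : ℝ)⁻¹ • ∑ n, localModels f W α x0 S k I n

/-- The generalization gap `F(x̄ᵏ) - F_S(x̄ᵏ)` for given data and given draws. -/
def genGap [MeasurableSpace Ξ] (f : Model d → Ξ → ℝ) (D : Fin N → Measure Ξ)
    (W : Matrix (Fin N) (Fin N) ℝ) (α : ℕ → ℝ) (x0 : Model d) (k : ℕ)
    (S : Dataset N Z Ξ) (I : Fin k → Fin N → Fin Z) : ℝ :=
  popLoss f D (output f W α x0 S k I) - empLoss f S (output f W α x0 S k I)

/-- The generalization error `𝔼_{S,𝓛}[F(x̄ᵏ) - F_S(x̄ᵏ)]`: integral over the data, and average over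
the draws, which are independent and uniform (that is, `I` is uniform on its finite type). -/
def genError [MeasurableSpace Ξ] (Z : ℕ) (f : Model d → Ξ → ℝ) (D : Fin N → Measure Ξ)
    (W : Matrix (Fin N) (Fin N) ℝ) (α : ℕ → ℝ) (x0 : Model d) (k : ℕ) : ℝ :=
  ∫ S, (Finset.univ : Finset (Fin k → Fin N → Fin Z)).expect
    (fun I => genGap f D W α x0 k S I) ∂(dataLaw Z D)

end Algorithm

end DSGD

end

/-!
Average over the data together with an independent copy of it. Exchanging one training sample for
its copy preserves the joint law, so the mean generalization gap equals the mean increase of the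
loss at a training sample caused by replacing that sample in the training set (on-average
stability).

To bound this increase, compare the runs on the two datasets with the same draws. A gradient step
contracts squared distances by `1 - (3/2) α μ`, averaging with the doubly stochastic matrix `W`
does not expand them, and a step sees the replaced sample with probability `1 / Z`, at one agent
out of `N`. With `αᵗ = 1 / (μ (t + k₀))` and `k ≍ μNZ`, the mean squared distance of the outputs
is thus of order `1 / (NZ)²`, up to the mean squared sample gradients along the run. Strong
convexity keeps these comparable to the ones at `x⁰`, and those are at most
`4σ² + 4δ² + 2L²‖x⁰ - x*_S‖²`, since the gradient of the empirical loss vanishes at `x*_S`.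
Finally, Young's inequality with weight `μNZ` turns the squared distance into an increase of the
loss of order `1 / (μNZ)`.
-/

namespace DSGD

section Scalars

theorem norm_sub_sq_le {E : Type*} [SeminormedAddGroup E] (x y : E) :
    ‖x - y‖ ^ 2 ≤ 2 * (‖x‖ ^ 2 + ‖y‖ ^ 2) :=
  (pow_le_pow_left₀ (norm_nonneg _) (norm_sub_le x y) 2).trans add_sq_le

theorem le_add_div_of_forall_succ_le {u : ℕ → ℝ} {q k₀ A B : ℝ} (hk₀ : 0 < k₀) (hq : q ≤ k₀)
    (hB : 0 ≤ B) (h0 : u 0 ≤ A + B / k₀)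
    (hu : ∀ t : ℕ, u (t + 1) ≤
      (1 - q / (t + k₀)) * u t + (q * A / (t + k₀) + (q - 1) * B / (t + k₀) ^ 2)) (t : ℕ) :
    u t ≤ A + B / (t + k₀) := by
  induction t with
  | zero => simpa using h0
  | succ t ih =>
    rw [Nat.cast_succ, add_right_comm]
    have hus := hu t
    have hs : k₀ ≤ t + k₀ := le_add_of_nonneg_left t.cast_nonneg
    set s : ℝ := t + k₀
    have hs0 : 0 < s := hk₀.trans_le hs
    have hqs : 0 ≤ 1 - q / s := sub_nonneg.2 ((div_le_one hs0).2 (hq.trans hs))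
    calc u (t + 1)
        ≤ (1 - q / s) * (A + B / s) + (q * A / s + (q - 1) * B / s ^ 2) := by
          linarith [mul_le_mul_of_nonneg_left ih hqs]
      _ = A + (B / (s + 1) - B / (s ^ 2 * (s + 1))) := by field_simp; ring
      _ ≤ A + B / (s + 1) := by
          have : 0 ≤ B / (s ^ 2 * (s + 1)) := by positivity
          linarith

end Scalars

section Averages

variable {ι κ M : Type*} [Fintype ι] [Fintype κ]

theorem inv_mul_sum_eq_expect {n : ℕ} (g : Fin n → ℝ) : (n : ℝ)⁻¹ * ∑ i, g i = 𝔼 i, g i := by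
  rw [Fintype.expect_eq_sum_div_card, Fintype.card_fin, div_eq_inv_mul]

theorem le_card_mul_expect {g : ι → ℝ} (hg : ∀ i, 0 ≤ g i) (i : ι) :
    g i ≤ Fintype.card ι * 𝔼 j, g j := by
  rw [Fintype.card_mul_expect]
  exact Finset.single_le_sum (fun j _ => hg j) (Finset.mem_univ i)

variable [AddCommMonoid M] [Module ℚ≥0 M]

theorem expect_prod (g : ι × κ → M) : 𝔼 p, g p = 𝔼 i, 𝔼 j, g (i, j) := by
  rw [← Finset.univ_product_univ, Finset.expect_product]

theorem expect_fst [Nonempty κ] (g : ι → M) : 𝔼 p : ι × κ, g p.1 = 𝔼 i, g i := by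
  simp only [expect_prod, Fintype.expect_const]

theorem expect_fin_succ {X : Type*} [Fintype X] {k : ℕ} (Φ : (Fin k → X) → X → M) :
    𝔼 I : Fin (k + 1) → X, Φ (fun t => I t.castSucc) (I (Fin.last k)) =
      𝔼 J : Fin k → X, 𝔼 x : X, Φ J x := by
  rw [Finset.expect_comm, ← expect_prod fun p : X × (Fin k → X) => Φ p.2 p.1]
  exact Fintype.expect_equiv (Fin.snocEquiv fun _ => X).symm _ _ fun _ => rfl

theorem expect_eval [DecidableEq ι] [Nonempty κ] (i : ι) (g : κ → M) :
    𝔼 x : ι → κ, g (x i) = 𝔼 y, g y := by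
  rw [← expect_fst (κ := { j // j ≠ i } → κ) g]
  exact Fintype.expect_equiv (Equiv.funSplitAt i κ) _ _ fun _ => rfl

theorem expect_add_ite_sq [DecidableEq ι] [Nonempty ι] (i : ι) (a b : ℝ) :
    𝔼 j, (a + if j = i then b else 0) ^ 2 = a ^ 2 + (2 * a * b + b ^ 2) / Fintype.card ι := by
  have h : ∀ j, (a + if j = i then b else 0) ^ 2 =
      a ^ 2 + if j = i then 2 * a * b + b ^ 2 else 0 := by
    intro j
    split_ifs <;> ring
  simp_rw [h, Finset.expect_add_distrib, Fintype.expect_const, Fintype.expect_eq_sum_div_card,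
    Finset.sum_ite_eq', if_pos (Finset.mem_univ i)]

theorem integrable_expect {Ω : Type*} [MeasurableSpace Ω] {P : Measure Ω} {F : ι → Ω → ℝ}
    (hF : ∀ i, Integrable (F i) P) : Integrable (fun ω => 𝔼 i, F i ω) P := by
  simp_rw [Fintype.expect_eq_sum_div_card]
  exact (integrable_finsetSum _ fun i _ => hF i).div_const _

theorem integral_expect {Ω : Type*} [MeasurableSpace Ω] {P : Measure Ω} {F : ι → Ω → ℝ}
    (hF : ∀ i, Integrable (F i) P) : ∫ ω, 𝔼 i, F i ω ∂P = 𝔼 i, ∫ ω, F i ω ∂P := by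
  simp_rw [Fintype.expect_eq_sum_div_card]
  rw [integral_div, integral_finsetSum _ fun i _ => hF i]

end Averages

section Mixing

variable {ι E : Type*} [Fintype ι] [SeminormedAddCommGroup E] [NormedSpace ℝ E]

theorem norm_sum_smul_pow_le {w : ι → ℝ} (hw : ∀ i, 0 ≤ w i) (hw1 : ∑ i, w i = 1) (v : ι → E)
    (p : ℕ) : ‖∑ i, w i • v i‖ ^ p ≤ ∑ i, w i * ‖v i‖ ^ p := by
  have h : ‖∑ i, w i • v i‖ ≤ ∑ i, w i * ‖v i‖ :=
    norm_sum_le_of_le _ fun i _ => by rw [norm_smul, Real.norm_of_nonneg (hw i)]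
  exact (pow_le_pow_left₀ (norm_nonneg _) h p).trans
    (Real.pow_arith_mean_le_arith_mean_pow _ _ _ (fun i _ => hw i) hw1
      (fun i _ => norm_nonneg _) p)

theorem norm_mean_pow_le {n : ℕ} [NeZero n] (v : Fin n → E) (p : ℕ) :
    ‖(n : ℝ)⁻¹ • ∑ i, v i‖ ^ p ≤ 𝔼 i, ‖v i‖ ^ p := by
  rw [Finset.smul_sum, ← inv_mul_sum_eq_expect, Finset.mul_sum]
  exact norm_sum_smul_pow_le (fun _ => by positivity) (by simp) v p

theorem expect_norm_sum_smul_pow_le [DecidableEq ι] {W : Matrix ι ι ℝ}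
    (hW : W ∈ doublyStochastic ℝ ι) (v : ι → E) (p : ℕ) :
    𝔼 n, ‖∑ m, W n m • v m‖ ^ p ≤ 𝔼 m, ‖v m‖ ^ p :=
  calc 𝔼 n, ‖∑ m, W n m • v m‖ ^ p ≤ 𝔼 n, ∑ m, W n m * ‖v m‖ ^ p :=
        Finset.expect_le_expect fun n _ => norm_sum_smul_pow_le
          (fun _ => nonneg_of_mem_doublyStochastic hW) (sum_row_of_mem_doublyStochastic hW n) v p
    _ = 𝔼 m, ‖v m‖ ^ p := by
        simp_rw [Fintype.expect_eq_sum_div_card]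
        rw [Finset.sum_comm]
        simp_rw [← Finset.sum_mul, sum_col_of_mem_doublyStochastic hW, one_mul]

theorem IsMixingMatrix.mem_doublyStochastic {N : ℕ} {G : SimpleGraph (Fin N)}
    {W : Matrix (Fin N) (Fin N) ℝ} (hW : IsMixingMatrix G W) : W ∈ doublyStochastic ℝ (Fin N) :=
  mem_doublyStochastic_iff_sum.2 ⟨fun n m => (hW.mem_Icc n m).1, hW.row_sum, hW.col_sum⟩

end Mixing

section StepSizes

/-- Step sizes `α ≤ min (1 / (2μ)) (μ / (4L²))`, for which a gradient step on a `μ`-strongly convex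
and `L`-smooth loss is a contraction whose rate is linear in `αμ`. -/
structure IsSmallStep (μ L α : ℝ) : Prop where
  pos : 0 < α
  mul_le_half : α * μ ≤ 1 / 2
  four_mul_mul_sq_le : 4 * (α * L ^ 2) ≤ μ

/-- The step sizes `αᵗ = 1 / (μ (t + k₀))` of the theorem. -/
noncomputable def harmonicStep (μ k₀ : ℝ) (t : ℕ) : ℝ := 1 / (μ * (t + k₀))

variable {μ L k₀ : ℝ}

theorem two_le_of_threshold_le (hk₀ : 2 + 4 * L ^ 2 / μ ^ 2 ≤ k₀) : 2 ≤ k₀ :=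
  le_trans (le_add_of_nonneg_right (by positivity)) hk₀

theorem harmonicStep_mul (hμ : μ ≠ 0) (t : ℕ) : harmonicStep μ k₀ t * μ = 1 / (t + k₀) := by
  rw [harmonicStep, one_div_mul_eq_div, div_mul_cancel_left₀ hμ, one_div]

theorem isSmallStep_harmonicStep (hμ : 0 < μ) (hk₀ : 2 + 4 * L ^ 2 / μ ^ 2 ≤ k₀) (t : ℕ) :
    IsSmallStep μ L (harmonicStep μ k₀ t) := by
  have hs : k₀ ≤ t + k₀ := le_add_of_nonneg_left t.cast_nonneg
  have hs2 : 2 ≤ t + k₀ := (two_le_of_threshold_le hk₀).trans hs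
  have hs0 : 0 < t + k₀ := by linarith
  refine ⟨one_div_pos.2 (mul_pos hμ hs0), ?_, ?_⟩
  · rw [harmonicStep_mul hμ.ne']
    exact one_div_le_one_div_of_le two_pos hs2
  · have h : 4 * L ^ 2 / μ ^ 2 ≤ t + k₀ := by linarith
    rw [div_le_iff₀ (by positivity)] at h
    rw [harmonicStep, one_div_mul_eq_div, ← mul_div_assoc, div_le_iff₀ (by positivity)]
    linarith

end StepSizes

section OneLoss

/-- One gradient step of size `α` on the loss `g`. -/
noncomputable def gradStep {d : ℕ} (α : ℝ) (g : Model d → ℝ) (x : Model d) : Model d :=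
  x - α • ∇ g x

variable {d : ℕ} {μ L α : ℝ} {g h : Model d → ℝ}

theorem StronglyConvex.mul_norm_sq_le_inner (hc : StronglyConvex μ g) (x y : Model d) :
    μ * ‖x - y‖ ^ 2 ≤ inner ℝ (x - y) (∇ g x - ∇ g y) := by
  have hxy := hc x y
  have hyx := hc y x
  rw [norm_sub_rev y x, ← neg_sub x y, inner_neg_left] at hyx
  rw [inner_sub_right]
  linarith

theorem Smooth.norm_gradient_le (hs : Smooth L g) (x p : Model d) :
    ‖∇ g x‖ ≤ ‖∇ g p‖ + L * ‖x - p‖ :=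
  (norm_le_norm_add_norm_sub' _ _).trans (add_le_add_right (hs.2 x p) _)

theorem Smooth.norm_gradient_sq_le (hs : Smooth L g) (x p : Model d) :
    ‖∇ g x‖ ^ 2 ≤ 2 * (‖∇ g p‖ ^ 2 + L ^ 2 * ‖x - p‖ ^ 2) :=
  calc ‖∇ g x‖ ^ 2 ≤ (‖∇ g p‖ + L * ‖x - p‖) ^ 2 :=
        pow_le_pow_left₀ (norm_nonneg _) (hs.norm_gradient_le x p) 2
    _ ≤ 2 * (‖∇ g p‖ ^ 2 + (L * ‖x - p‖) ^ 2) := add_sq_le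
    _ = 2 * (‖∇ g p‖ ^ 2 + L ^ 2 * ‖x - p‖ ^ 2) := by rw [mul_pow]

theorem norm_gradStep_sub_gradStep_sq_le (hc : StronglyConvex μ g) (hs : Smooth L g)
    (hα : IsSmallStep μ L α) (x y : Model d) :
    ‖gradStep α g x - gradStep α g y‖ ^ 2 ≤ (1 - 7 / 4 * (α * μ)) * ‖x - y‖ ^ 2 := by
  have hα0 : 0 ≤ α := hα.pos.le
  have hmono : α * (μ * ‖x - y‖ ^ 2) ≤ α * inner ℝ (x - y) (∇ g x - ∇ g y) :=
    mul_le_mul_of_nonneg_left (hc.mul_norm_sq_le_inner x y) hα0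
  have hlip : ‖∇ g x - ∇ g y‖ ^ 2 ≤ (L * ‖x - y‖) ^ 2 :=
    pow_le_pow_left₀ (norm_nonneg _) (hs.2 x y) 2
  calc ‖gradStep α g x - gradStep α g y‖ ^ 2
      = ‖(x - y) - α • (∇ g x - ∇ g y)‖ ^ 2 := by
        rw [gradStep, gradStep, smul_sub, sub_sub_sub_comm]
    _ = ‖x - y‖ ^ 2 - 2 * (α * inner ℝ (x - y) (∇ g x - ∇ g y))
          + α ^ 2 * ‖∇ g x - ∇ g y‖ ^ 2 := by
        rw [norm_sub_sq_real, inner_smul_right, norm_smul, Real.norm_of_nonneg hα0, mul_pow]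
    _ ≤ ‖x - y‖ ^ 2 - 2 * (α * (μ * ‖x - y‖ ^ 2)) + α ^ 2 * (L * ‖x - y‖) ^ 2 := by gcongr
    _ = (1 - 2 * (α * μ) + α * (α * L ^ 2)) * ‖x - y‖ ^ 2 := by ring
    _ ≤ (1 - 7 / 4 * (α * μ)) * ‖x - y‖ ^ 2 := by
        gcongr
        linarith [mul_le_mul_of_nonneg_left hα.four_mul_mul_sq_le hα0]

theorem norm_gradStep_sub_gradStep_le (hc : StronglyConvex μ g) (hs : Smooth L g)
    (hα : IsSmallStep μ L α) (x y : Model d) :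
    ‖gradStep α g x - gradStep α g y‖ ≤ √(1 - 7 / 4 * (α * μ)) * ‖x - y‖ := by
  have h0 : 0 ≤ 1 - 7 / 4 * (α * μ) := by linarith [hα.mul_le_half]
  rw [← Real.sqrt_sq (norm_nonneg (x - y)), ← Real.sqrt_mul h0]
  exact Real.le_sqrt_of_sq_le (norm_gradStep_sub_gradStep_sq_le hc hs hα x y)

theorem norm_gradStep_sub_gradStep_le_add (hc : StronglyConvex μ g) (hs : Smooth L g)
    (hα : IsSmallStep μ L α) (x y : Model d) :
    ‖gradStep α g x - gradStep α h y‖ ≤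
      √(1 - 7 / 4 * (α * μ)) * ‖x - y‖ + α * ‖∇ g y - ∇ h y‖ := by
  have hdiff : ‖gradStep α g y - gradStep α h y‖ = α * ‖∇ g y - ∇ h y‖ := by
    rw [gradStep, gradStep, sub_sub_sub_cancel_left, ← smul_sub, norm_smul,
      Real.norm_of_nonneg hα.pos.le, norm_sub_rev]
  exact (norm_sub_le_norm_sub_add_norm_sub _ (gradStep α g y) _).trans
    (add_le_add (norm_gradStep_sub_gradStep_le hc hs hα x y) hdiff.le)

theorem norm_gradStep_sub_sq_le (hc : StronglyConvex μ g) (hs : Smooth L g) (hμ : 0 < μ)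
    (hα : IsSmallStep μ L α) (x p : Model d) :
    ‖gradStep α g x - p‖ ^ 2 ≤
      (1 - α * μ) * ‖x - p‖ ^ 2 + 3 * α / μ * ‖∇ g p‖ ^ 2 := by
  have hα0 := hα.pos
  set r := ‖x - p‖
  set G := ‖∇ g p‖
  have hinner : μ * r ^ 2 - r * G ≤ inner ℝ (x - p) (∇ g x) := by
    have hmono := hc.mul_norm_sq_le_inner x p
    rw [inner_sub_right] at hmono
    linarith [neg_le_of_abs_le (abs_real_inner_le_norm (x - p) (∇ g p))]
  have hyoung : 2 * r * G ≤ μ / 2 * r ^ 2 + (μ / 2)⁻¹ * G ^ 2 :=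
    two_mul_le_add_mul_sq (half_pos hμ)
  calc ‖gradStep α g x - p‖ ^ 2
      = r ^ 2 - 2 * (α * inner ℝ (x - p) (∇ g x)) + α * (α * ‖∇ g x‖ ^ 2) := by
        rw [gradStep, sub_right_comm, norm_sub_sq_real, inner_smul_right, norm_smul,
          Real.norm_of_nonneg hα0.le, mul_pow, sq α, mul_assoc α α]
    _ ≤ r ^ 2 - 2 * (α * (μ * r ^ 2 - r * G)) + α * (α * (2 * (G ^ 2 + L ^ 2 * r ^ 2))) := by
        gcongr
        exact hs.norm_gradient_sq_le x p
    _ = (1 - 2 * (α * μ)) * r ^ 2 + α * (2 * r * G + 2 * α * G ^ 2 + 2 * (α * L ^ 2) * r ^ 2) := by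
        ring
    _ ≤ (1 - 2 * (α * μ)) * r ^ 2 +
          α * (μ / 2 * r ^ 2 + (μ / 2)⁻¹ * G ^ 2 + 1 / μ * G ^ 2 + μ / 2 * r ^ 2) := by
        gcongr
        · rw [le_div_iff₀ hμ]
          linarith [hα.mul_le_half]
        · linarith [hα.four_mul_mul_sq_le]
    _ = (1 - α * μ) * r ^ 2 + 3 * α / μ * G ^ 2 := by field_simp; ring

theorem sub_le_norm_gradient_mul (hc : StronglyConvex μ g) (hs : Smooth L g) (hμ : 0 ≤ μ)
    (x y : Model d) : g y - g x ≤ ‖∇ g x‖ * ‖y - x‖ + L * ‖y - x‖ ^ 2 := by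
  have hxy := hc x y
  rw [← neg_sub y x, inner_neg_left, norm_neg] at hxy
  have hsq : 0 ≤ μ / 2 * ‖y - x‖ ^ 2 := by positivity
  calc g y - g x ≤ inner ℝ (y - x) (∇ g y) := by linarith
    _ ≤ ‖y - x‖ * ‖∇ g y‖ := real_inner_le_norm _ _
    _ ≤ ‖y - x‖ * (‖∇ g x‖ + L * ‖y - x‖) := by gcongr; exact hs.norm_gradient_le y x
    _ = ‖∇ g x‖ * ‖y - x‖ + L * ‖y - x‖ ^ 2 := by ring

theorem abs_sub_le_norm_gradient_mul (hc : StronglyConvex μ g) (hs : Smooth L g) (hμ : 0 ≤ μ)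
    (hL : 0 ≤ L) (x y : Model d) :
    |g y - g x| ≤ ‖∇ g x‖ * ‖y - x‖ + L * ‖y - x‖ ^ 2 := by
  refine abs_le.2 ⟨?_, sub_le_norm_gradient_mul hc hs hμ x y⟩
  have hyx := hc y x
  have hinner := neg_le_of_abs_le (abs_real_inner_le_norm (y - x) (∇ g x))
  have hμr : 0 ≤ μ / 2 * ‖y - x‖ ^ 2 := by positivity
  have hLr : 0 ≤ L * ‖y - x‖ ^ 2 := by positivity
  linarith [mul_comm ‖∇ g x‖ ‖y - x‖]

theorem sub_le_inv_mul_norm_gradient_sq (hc : StronglyConvex μ g) (hs : Smooth L g) (hμ : 0 ≤ μ)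
    {c : ℝ} (hcpos : 0 < c) (x y : Model d) :
    g y - g x ≤ c⁻¹ * ‖∇ g x‖ ^ 2 + (c / 4 + L) * ‖y - x‖ ^ 2 := by
  have hyoung : 2 * ‖y - x‖ * ‖∇ g x‖ ≤ c / 2 * ‖y - x‖ ^ 2 + (c / 2)⁻¹ * ‖∇ g x‖ ^ 2 :=
    two_mul_le_add_mul_sq (half_pos hcpos)
  rw [inv_div, div_eq_mul_inv 2 c] at hyoung
  linarith [sub_le_norm_gradient_mul hc hs hμ x y]

end OneLoss

section Trajectories

variable {d N Z : ℕ} {Ξ : Type*}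

/-- The mean squared norm of the gradients at `x` of the losses at the samples of `S`; at `x⁰` it
controls how far all runs of the algorithm move. -/
noncomputable def meanSqGrad (f : Model d → Ξ → ℝ) (S : Dataset N Z Ξ) (x : Model d) : ℝ :=
  𝔼 i, ‖∇ (fun y => f y (S i)) x‖ ^ 2

/-- The mean distance over the agents, after `k` steps, between the runs on the datasets `S` and
`S'` with the same draws `I`. -/
noncomputable def runDist (f : Model d → Ξ → ℝ) (W : Matrix (Fin N) (Fin N) ℝ) (α : ℕ → ℝ)
    (x0 : Model d) (S S' : Dataset N Z Ξ) (k : ℕ) (I : Fin k → Fin N → Fin Z) : ℝ :=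
  𝔼 n, ‖localModels f W α x0 S' k I n - localModels f W α x0 S k I n‖

variable {f : Model d → Ξ → ℝ} {W : Matrix (Fin N) (Fin N) ℝ} {α : ℕ → ℝ} {μ L : ℝ}

theorem meanSqGrad_nonneg (S : Dataset N Z Ξ) (x : Model d) : 0 ≤ meanSqGrad f S x :=
  Finset.expect_nonneg fun _ _ => sq_nonneg _

theorem runDist_nonneg (x0 : Model d) (S S' : Dataset N Z Ξ) (k : ℕ)
    (I : Fin k → Fin N → Fin Z) : 0 ≤ runDist f W α x0 S S' k I :=
  Finset.expect_nonneg fun _ _ => norm_nonneg _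

theorem localModels_succ (x0 : Model d) (S : Dataset N Z Ξ) (k : ℕ)
    (I : Fin (k + 1) → Fin N → Fin Z) (n : Fin N) :
    localModels f W α x0 S (k + 1) I n = ∑ m, W n m •
      gradStep (α k) (fun y => f y (S (m, I (Fin.last k) m)))
        (localModels f W α x0 S k (fun t => I t.castSucc) m) :=
  rfl

theorem expect_norm_localModels_succ_sub_sq_le (hW : W ∈ doublyStochastic ℝ (Fin N))
    (x0 p : Model d) (S : Dataset N Z Ξ) (k : ℕ) (I : Fin (k + 1) → Fin N → Fin Z) :
    𝔼 n, ‖localModels f W α x0 S (k + 1) I n - p‖ ^ 2 ≤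
      𝔼 m, ‖gradStep (α k) (fun y => f y (S (m, I (Fin.last k) m)))
        (localModels f W α x0 S k (fun t => I t.castSucc) m) - p‖ ^ 2 := by
  refine le_trans (Finset.expect_congr rfl fun n _ => ?_).le
    (expect_norm_sum_smul_pow_le hW _ 2)
  simp_rw [smul_sub _ _ p]
  rw [localModels_succ, Finset.sum_sub_distrib, ← Finset.sum_smul,
    sum_row_of_mem_doublyStochastic hW, one_smul]

theorem expect_norm_gradStep_sub_sq_le [NeZero Z] (hc : ∀ ξ, StronglyConvex μ fun x => f x ξ)
    (hs : ∀ ξ, Smooth L fun x => f x ξ) (hμ : 0 < μ) {α : ℝ} (hα : IsSmallStep μ L α)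
    (S : Dataset N Z Ξ) (X : Fin N → Model d) (p : Model d) :
    𝔼 x : Fin N → Fin Z, 𝔼 m, ‖gradStep α (fun y => f y (S (m, x m))) (X m) - p‖ ^ 2 ≤
      (1 - α * μ) * 𝔼 m, ‖X m - p‖ ^ 2 + 3 * α / μ * meanSqGrad f S p :=
  calc 𝔼 x : Fin N → Fin Z, 𝔼 m, ‖gradStep α (fun y => f y (S (m, x m))) (X m) - p‖ ^ 2
      = 𝔼 i, ‖gradStep α (fun y => f y (S i)) (X i.1) - p‖ ^ 2 := by
        rw [Finset.expect_comm, expect_prod]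
        exact Finset.expect_congr rfl fun m _ =>
          expect_eval m fun z => ‖gradStep α (fun y => f y (S (m, z))) (X m) - p‖ ^ 2
    _ ≤ 𝔼 i, ((1 - α * μ) * ‖X i.1 - p‖ ^ 2
          + 3 * α / μ * ‖∇ (fun y => f y (S i)) p‖ ^ 2) :=
        Finset.expect_le_expect fun i _ =>
          norm_gradStep_sub_sq_le (hc (S i)) (hs (S i)) hμ hα (X i.1) p
    _ = (1 - α * μ) * 𝔼 m, ‖X m - p‖ ^ 2 + 3 * α / μ * meanSqGrad f S p := by
        rw [Finset.expect_add_distrib, ← Finset.mul_expect, ← Finset.mul_expect,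
          expect_fst fun m => ‖X m - p‖ ^ 2, meanSqGrad]

theorem expect_norm_localModels_sub_sq_le [NeZero Z] (hW : W ∈ doublyStochastic ℝ (Fin N))
    (hc : ∀ ξ, StronglyConvex μ fun x => f x ξ) (hs : ∀ ξ, Smooth L fun x => f x ξ) (hμ : 0 < μ)
    (hα : ∀ t, IsSmallStep μ L (α t)) (x0 : Model d) (S : Dataset N Z Ξ) (k : ℕ) :
    𝔼 I : Fin k → Fin N → Fin Z, 𝔼 n, ‖localModels f W α x0 S k I n - x0‖ ^ 2 ≤
      3 / μ ^ 2 * meanSqGrad f S x0 := by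
  induction k with
  | zero =>
    simpa only [localModels, sub_self, norm_zero, ne_eq, OfNat.ofNat_ne_zero, not_false_eq_true,
      zero_pow, Finset.expect_const_zero] using
      mul_nonneg (by positivity) (meanSqGrad_nonneg S x0)
  | succ k ih =>
    have hrate : 0 ≤ 1 - α k * μ := by linarith [(hα k).mul_le_half]
    calc 𝔼 I : Fin (k + 1) → Fin N → Fin Z,
          𝔼 n, ‖localModels f W α x0 S (k + 1) I n - x0‖ ^ 2
        ≤ 𝔼 J : Fin k → Fin N → Fin Z, 𝔼 x : Fin N → Fin Z,
            𝔼 m, ‖gradStep (α k) (fun y => f y (S (m, x m)))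
              (localModels f W α x0 S k J m) - x0‖ ^ 2 :=
          (Finset.expect_le_expect fun I _ =>
            expect_norm_localModels_succ_sub_sq_le hW x0 x0 S k I).trans
            (expect_fin_succ fun (J : Fin k → Fin N → Fin Z) (x : Fin N → Fin Z) =>
              𝔼 m, ‖gradStep (α k) (fun y => f y (S (m, x m)))
                (localModels f W α x0 S k J m) - x0‖ ^ 2).le
      _ ≤ 𝔼 J : Fin k → Fin N → Fin Z, ((1 - α k * μ) *
            𝔼 n, ‖localModels f W α x0 S k J n - x0‖ ^ 2 + 3 * α k / μ * meanSqGrad f S x0) :=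
          Finset.expect_le_expect fun J _ =>
            expect_norm_gradStep_sub_sq_le hc hs hμ (hα k) S (localModels f W α x0 S k J) x0
      _ = (1 - α k * μ) * 𝔼 J : Fin k → Fin N → Fin Z,
            𝔼 n, ‖localModels f W α x0 S k J n - x0‖ ^ 2 + 3 * α k / μ * meanSqGrad f S x0 := by
          rw [Finset.expect_add_distrib, Fintype.expect_const, ← Finset.mul_expect]
      _ ≤ (1 - α k * μ) * (3 / μ ^ 2 * meanSqGrad f S x0)
            + 3 * α k / μ * meanSqGrad f S x0 := by gcongr
      _ = 3 / μ ^ 2 * meanSqGrad f S x0 := by field_simp; ring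

theorem expect_norm_gradient_localModels_sq_le [NeZero N] [NeZero Z]
    (hW : W ∈ doublyStochastic ℝ (Fin N)) (hc : ∀ ξ, StronglyConvex μ fun x => f x ξ)
    (hs : ∀ ξ, Smooth L fun x => f x ξ) (hμ : 0 < μ) (hα : ∀ t, IsSmallStep μ L (α t))
    (x0 : Model d) (S S' : Dataset N Z Ξ) (k : ℕ) :
    𝔼 i : Fin N × Fin Z, 𝔼 I : Fin k → Fin N → Fin Z,
        ‖∇ (fun y => f y (S' i)) (localModels f W α x0 S k I i.1)‖ ^ 2 ≤
      2 * (meanSqGrad f S' x0 + L ^ 2 * (3 / μ ^ 2 * meanSqGrad f S x0)) :=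
  calc 𝔼 i : Fin N × Fin Z, 𝔼 I : Fin k → Fin N → Fin Z,
        ‖∇ (fun y => f y (S' i)) (localModels f W α x0 S k I i.1)‖ ^ 2
      ≤ 𝔼 i : Fin N × Fin Z, 𝔼 I : Fin k → Fin N → Fin Z,
          2 * (‖∇ (fun y => f y (S' i)) x0‖ ^ 2
            + L ^ 2 * ‖localModels f W α x0 S k I i.1 - x0‖ ^ 2) :=
        Finset.expect_le_expect fun i _ => Finset.expect_le_expect fun I _ =>
          (hs (S' i)).norm_gradient_sq_le _ _
    _ = 2 * (meanSqGrad f S' x0 + L ^ 2 * 𝔼 I : Fin k → Fin N → Fin Z,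
          𝔼 n, ‖localModels f W α x0 S k I n - x0‖ ^ 2) := by
        simp_rw [← Finset.mul_expect, Finset.expect_add_distrib, Fintype.expect_const,
          ← Finset.mul_expect]
        rw [expect_fst fun n => 𝔼 I : Fin k → Fin N → Fin Z,
          ‖localModels f W α x0 S k I n - x0‖ ^ 2, Finset.expect_comm, meanSqGrad]
    _ ≤ 2 * (meanSqGrad f S' x0 + L ^ 2 * (3 / μ ^ 2 * meanSqGrad f S x0)) := by
        gcongr
        exact expect_norm_localModels_sub_sq_le hW hc hs hμ hα x0 S k

end Trajectories

section Stability

variable {d N Z : ℕ} {Ξ : Type*} {f : Model d → Ξ → ℝ} {W : Matrix (Fin N) (Fin N) ℝ}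
  {α : ℕ → ℝ} {μ L : ℝ}

theorem runDist_succ_le (hW : W ∈ doublyStochastic ℝ (Fin N))
    (hc : ∀ ξ, StronglyConvex μ fun x => f x ξ) (hs : ∀ ξ, Smooth L fun x => f x ξ)
    (hα : ∀ t, IsSmallStep μ L (α t)) (x0 : Model d) (S S' : Dataset N Z Ξ) (k : ℕ)
    (I : Fin (k + 1) → Fin N → Fin Z) :
    runDist f W α x0 S S' (k + 1) I ≤
      √(1 - 7 / 4 * (α k * μ)) * runDist f W α x0 S S' k (fun t => I t.castSucc) +
        α k * 𝔼 m, ‖∇ (fun y => f y (S' (m, I (Fin.last k) m)))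
              (localModels f W α x0 S k (fun t => I t.castSucc) m)
            - ∇ (fun y => f y (S (m, I (Fin.last k) m)))
              (localModels f W α x0 S k (fun t => I t.castSucc) m)‖ := by
  simp only [runDist, localModels_succ, ← Finset.sum_sub_distrib, ← smul_sub, Finset.mul_expect,
    ← Finset.expect_add_distrib]
  have hmix := expect_norm_sum_smul_pow_le hW (fun m =>
    gradStep (α k) (fun y => f y (S' (m, I (Fin.last k) m)))
        (localModels f W α x0 S' k (fun t => I t.castSucc) m)
      - gradStep (α k) (fun y => f y (S (m, I (Fin.last k) m)))
        (localModels f W α x0 S k (fun t => I t.castSucc) m)) 1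
  simp only [pow_one] at hmix
  exact hmix.trans (Finset.expect_le_expect fun m _ =>
    norm_gradStep_sub_gradStep_le_add (hc _) (hs _) (hα k) _ _)

theorem expect_norm_gradient_update_sub (S : Dataset N Z Ξ) (i : Fin N × Fin Z) (ξ : Ξ)
    (x : Fin N → Fin Z) (X : Fin N → Model d) :
    𝔼 m, ‖∇ (fun y => f y (Function.update S i ξ (m, x m))) (X m)
        - ∇ (fun y => f y (S (m, x m))) (X m)‖ =
      if x i.1 = i.2 then
        ‖∇ (fun y => f y ξ) (X i.1) - ∇ (fun y => f y (S i)) (X i.1)‖ / N else 0 := by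
  have hne : ∀ m, m ≠ i.1 → ‖∇ (fun y => f y (Function.update S i ξ (m, x m))) (X m)
      - ∇ (fun y => f y (S (m, x m))) (X m)‖ = 0 := fun m hm => by
    rw [Function.update_of_ne fun h => hm (congrArg Prod.fst h), sub_self, norm_zero]
  rw [Fintype.expect_eq_sum_div_card, Fintype.card_fin, Fintype.sum_eq_single i.1 hne]
  split_ifs with hx
  · rw [hx, Prod.mk.eta, Function.update_self]
  · rw [Function.update_of_ne fun h => hx (congrArg Prod.snd h), sub_self, norm_zero, zero_div]

theorem expect_add_ite_sq_le [NeZero N] [NeZero Z] (hμ : 0 < μ) {α : ℝ}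
    (hα : IsSmallStep μ L α) {r h : ℝ} (hr : 0 ≤ r) (hh : 0 ≤ h) (z : Fin Z) :
    𝔼 z', (√(1 - 7 / 4 * (α * μ)) * r + if z' = z then α * (h / N) else 0) ^ 2 ≤
      (1 - 3 / 2 * (α * μ)) * r ^ 2 +
        (4 * α / (μ * (N * Z) ^ 2) + α ^ 2 / (N ^ 2 * Z)) * h ^ 2 := by
  have hα0 := hα.pos
  have hαμ : 0 < α * μ := mul_pos hα0 hμ
  have hZ : (Z : ℝ) ≠ 0 := NeZero.ne _
  have hyoung : 2 * r * (h / (N * Z)) ≤ μ / 4 * r ^ 2 + (μ / 4)⁻¹ * (h / (N * Z)) ^ 2 :=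
    two_mul_le_add_mul_sq (by positivity)
  have hcross : 2 * (√(1 - 7 / 4 * (α * μ)) * r) * (α * (h / N)) / Z ≤
      α * (μ / 4 * r ^ 2 + (μ / 4)⁻¹ * (h / (N * Z)) ^ 2) :=
    calc 2 * (√(1 - 7 / 4 * (α * μ)) * r) * (α * (h / N)) / Z
        ≤ 2 * (1 * r) * (α * (h / N)) / Z := by
          gcongr
          exact Real.sqrt_le_one.2 (by linarith)
      _ = α * (2 * r * (h / (N * Z))) := by field_simp
      _ ≤ α * (μ / 4 * r ^ 2 + (μ / 4)⁻¹ * (h / (N * Z)) ^ 2) := by gcongr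
  rw [expect_add_ite_sq, Fintype.card_fin, mul_pow,
    Real.sq_sqrt (by linarith [hα.mul_le_half]), add_div]
  refine (add_le_add_right (add_le_add_left hcross _) _).trans (le_of_eq ?_)
  field_simp
  ring

theorem expect_runDist_update_sq_succ_le [NeZero N] [NeZero Z]
    (hW : W ∈ doublyStochastic ℝ (Fin N)) (hc : ∀ ξ, StronglyConvex μ fun x => f x ξ)
    (hs : ∀ ξ, Smooth L fun x => f x ξ) (hμ : 0 < μ) (hα : ∀ t, IsSmallStep μ L (α t))
    (x0 : Model d) (S : Dataset N Z Ξ) (i : Fin N × Fin Z) (ξ : Ξ) (k : ℕ) :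
    𝔼 I, runDist f W α x0 S (Function.update S i ξ) (k + 1) I ^ 2 ≤
      (1 - 3 / 2 * (α k * μ)) * 𝔼 I, runDist f W α x0 S (Function.update S i ξ) k I ^ 2 +
      (4 * α k / (μ * (N * Z) ^ 2) + α k ^ 2 / (N ^ 2 * Z)) *
        𝔼 I : Fin k → Fin N → Fin Z, ‖∇ (fun y => f y ξ) (localModels f W α x0 S k I i.1)
          - ∇ (fun y => f y (S i)) (localModels f W α x0 S k I i.1)‖ ^ 2 := by
  set r := runDist f W α x0 S (Function.update S i ξ) k
  set h := fun J : Fin k → Fin N → Fin Z =>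
    ‖∇ (fun y => f y ξ) (localModels f W α x0 S k J i.1)
      - ∇ (fun y => f y (S i)) (localModels f W α x0 S k J i.1)‖
  set c := √(1 - 7 / 4 * (α k * μ))
  have hstep : ∀ I, runDist f W α x0 S (Function.update S i ξ) (k + 1) I ^ 2 ≤
      (c * r (fun t => I t.castSucc)
        + if I (Fin.last k) i.1 = i.2 then α k * (h (fun t => I t.castSucc) / N) else 0) ^ 2 := by
    intro I
    have hI := runDist_succ_le hW hc hs hα x0 S (Function.update S i ξ) k I
    rw [expect_norm_gradient_update_sub, mul_ite, mul_zero] at hI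
    exact pow_le_pow_left₀ (runDist_nonneg _ _ _ _ _) hI 2
  calc 𝔼 I, runDist f W α x0 S (Function.update S i ξ) (k + 1) I ^ 2
      ≤ 𝔼 J, 𝔼 x : Fin N → Fin Z,
          (c * r J + if x i.1 = i.2 then α k * (h J / N) else 0) ^ 2 :=
        (Finset.expect_le_expect fun I _ => hstep I).trans
          (expect_fin_succ fun J (x : Fin N → Fin Z) =>
            (c * r J + if x i.1 = i.2 then α k * (h J / N) else 0) ^ 2).le
    _ = 𝔼 J, 𝔼 z, (c * r J + if z = i.2 then α k * (h J / N) else 0) ^ 2 :=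
        Finset.expect_congr rfl fun J _ =>
          expect_eval i.1 fun z => (c * r J + if z = i.2 then α k * (h J / N) else 0) ^ 2
    _ ≤ _ := Finset.expect_le_expect fun J _ => expect_add_ite_sq_le hμ (hα k)
        (runDist_nonneg _ _ _ _ _) (norm_nonneg _) i.2
    _ = _ := by rw [Finset.expect_add_distrib, ← Finset.mul_expect, ← Finset.mul_expect]

theorem expect_norm_gradient_sub_sq_le [NeZero N] [NeZero Z]
    (hW : W ∈ doublyStochastic ℝ (Fin N)) (hc : ∀ ξ, StronglyConvex μ fun x => f x ξ)
    (hs : ∀ ξ, Smooth L fun x => f x ξ) (hμ : 0 < μ) (hα : ∀ t, IsSmallStep μ L (α t))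
    (x0 : Model d) (S S' : Dataset N Z Ξ) (k : ℕ) :
    𝔼 i : Fin N × Fin Z, 𝔼 I : Fin k → Fin N → Fin Z,
        ‖∇ (fun y => f y (S' i)) (localModels f W α x0 S k I i.1)
          - ∇ (fun y => f y (S i)) (localModels f W α x0 S k I i.1)‖ ^ 2 ≤
      (4 + 24 * L ^ 2 / μ ^ 2) * (meanSqGrad f S x0 + meanSqGrad f S' x0) := by
  have hS := expect_norm_gradient_localModels_sq_le hW hc hs hμ hα x0 S S k
  have hS' := expect_norm_gradient_localModels_sq_le hW hc hs hμ hα x0 S S' k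
  set w := meanSqGrad f S x0
  set w' := meanSqGrad f S' x0
  have hw' : 0 ≤ 24 * L ^ 2 / μ ^ 2 * w' := mul_nonneg (by positivity) (meanSqGrad_nonneg S' x0)
  calc 𝔼 i : Fin N × Fin Z, 𝔼 I : Fin k → Fin N → Fin Z,
        ‖∇ (fun y => f y (S' i)) (localModels f W α x0 S k I i.1)
          - ∇ (fun y => f y (S i)) (localModels f W α x0 S k I i.1)‖ ^ 2
      ≤ 𝔼 i : Fin N × Fin Z, 𝔼 I : Fin k → Fin N → Fin Z,
          2 * (‖∇ (fun y => f y (S' i)) (localModels f W α x0 S k I i.1)‖ ^ 2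
            + ‖∇ (fun y => f y (S i)) (localModels f W α x0 S k I i.1)‖ ^ 2) :=
        Finset.expect_le_expect fun i _ => Finset.expect_le_expect fun I _ =>
          norm_sub_sq_le _ _
    _ ≤ 2 * (2 * (w' + L ^ 2 * (3 / μ ^ 2 * w)) + 2 * (w + L ^ 2 * (3 / μ ^ 2 * w))) := by
        simp_rw [← Finset.mul_expect, Finset.expect_add_distrib]
        gcongr
    _ = (4 + 24 * L ^ 2 / μ ^ 2) * (w + w') - 24 * L ^ 2 / μ ^ 2 * w' := by ring
    _ ≤ (4 + 24 * L ^ 2 / μ ^ 2) * (w + w') := sub_le_self _ hw'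

theorem expect_expect_runDist_update_sq_succ_le [NeZero N] [NeZero Z]
    (hW : W ∈ doublyStochastic ℝ (Fin N)) (hc : ∀ ξ, StronglyConvex μ fun x => f x ξ)
    (hs : ∀ ξ, Smooth L fun x => f x ξ) (hμ : 0 < μ) (hα : ∀ t, IsSmallStep μ L (α t))
    (x0 : Model d) (S S' : Dataset N Z Ξ) (k : ℕ) :
    𝔼 i, 𝔼 I, runDist f W α x0 S (Function.update S i (S' i)) (k + 1) I ^ 2 ≤
      (1 - 3 / 2 * (α k * μ)) *
        𝔼 i, 𝔼 I, runDist f W α x0 S (Function.update S i (S' i)) k I ^ 2 +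
      (4 * α k / (μ * (N * Z) ^ 2) + α k ^ 2 / (N ^ 2 * Z)) *
        ((4 + 24 * L ^ 2 / μ ^ 2) * (meanSqGrad f S x0 + meanSqGrad f S' x0)) := by
  have := (hα k).pos
  refine (Finset.expect_le_expect fun i _ =>
    expect_runDist_update_sq_succ_le hW hc hs hμ hα x0 S i (S' i) k).trans ?_
  rw [Finset.expect_add_distrib, ← Finset.mul_expect, ← Finset.mul_expect]
  gcongr
  exact expect_norm_gradient_sub_sq_le hW hc hs hμ hα x0 S S' k

theorem expect_expect_runDist_update_sq_le [NeZero N] [NeZero Z]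
    (hW : W ∈ doublyStochastic ℝ (Fin N)) (hc : ∀ ξ, StronglyConvex μ fun x => f x ξ)
    (hs : ∀ ξ, Smooth L fun x => f x ξ) (hμ : 0 < μ) {k₀ : ℝ}
    (hk₀ : 2 + 4 * L ^ 2 / μ ^ 2 ≤ k₀) (x0 : Model d) (S S' : Dataset N Z Ξ) (k : ℕ) :
    𝔼 i, 𝔼 I, runDist f W (harmonicStep μ k₀) x0 S (Function.update S i (S' i)) k I ^ 2 ≤
      (8 / 3 / (μ * (N * Z)) ^ 2 + 2 / ((μ * N) ^ 2 * Z) / (k + k₀)) *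
        ((4 + 24 * L ^ 2 / μ ^ 2) * (meanSqGrad f S x0 + meanSqGrad f S' x0)) := by
  have h2k₀ : 2 ≤ k₀ := two_le_of_threshold_le hk₀
  have hstep := expect_expect_runDist_update_sq_succ_le hW hc hs hμ
    (isSmallStep_harmonicStep hμ hk₀) x0 S S'
  set H := (4 + 24 * L ^ 2 / μ ^ 2) * (meanSqGrad f S x0 + meanSqGrad f S' x0)
  have hH : 0 ≤ H :=
    mul_nonneg (by positivity) (add_nonneg (meanSqGrad_nonneg S x0) (meanSqGrad_nonneg S' x0))
  have hrec := le_add_div_of_forall_succ_le (q := 3 / 2) (k₀ := k₀)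
    (u := fun k => 𝔼 i, 𝔼 I,
      runDist f W (harmonicStep μ k₀) x0 S (Function.update S i (S' i)) k I ^ 2)
    (A := 8 / 3 / (μ * (N * Z)) ^ 2 * H) (B := 2 / ((μ * N) ^ 2 * Z) * H)
    (by linarith) (by linarith) (by positivity) ?_ (fun t => ?_) k
  · exact hrec.trans_eq (by ring)
  · simp only [runDist, localModels, sub_self, norm_zero, Finset.expect_const_zero, ne_eq,
      OfNat.ofNat_ne_zero, not_false_eq_true, zero_pow]
    positivity
  · refine (hstep t).trans_eq ?_
    have hs0 : (t : ℝ) + k₀ ≠ 0 := by positivity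
    rw [harmonicStep]
    field_simp
    ring

end Stability

section LossIncrease

variable {d N Z : ℕ} {Ξ : Type*} {f : Model d → Ξ → ℝ} {W : Matrix (Fin N) (Fin N) ℝ}
  {α : ℕ → ℝ} {μ L : ℝ}

theorem norm_output_sub_sq_le [NeZero N] (x0 p : Model d) (S : Dataset N Z Ξ) (k : ℕ)
    (I : Fin k → Fin N → Fin Z) :
    ‖output f W α x0 S k I - p‖ ^ 2 ≤ 𝔼 n, ‖localModels f W α x0 S k I n - p‖ ^ 2 := by
  refine le_of_eq_of_le ?_ (norm_mean_pow_le _ 2)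
  rw [Finset.sum_sub_distrib, smul_sub, Finset.sum_const, Finset.card_univ, Fintype.card_fin,
    ← Nat.cast_smul_eq_nsmul ℝ, inv_smul_smul₀ (NeZero.ne _), output]

theorem norm_output_sub_output_le [NeZero N] (x0 : Model d) (S S' : Dataset N Z Ξ) (k : ℕ)
    (I : Fin k → Fin N → Fin Z) :
    ‖output f W α x0 S' k I - output f W α x0 S k I‖ ≤ runDist f W α x0 S S' k I := by
  rw [output, output, runDist, ← smul_sub, ← Finset.sum_sub_distrib]
  simpa only [pow_one] using norm_mean_pow_le
    (fun n => localModels f W α x0 S' k I n - localModels f W α x0 S k I n) 1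

theorem meanSqGrad_le [NeZero N] [NeZero Z] (hs : ∀ ξ, Smooth L fun x => f x ξ)
    (S : Dataset N Z Ξ) (x p : Model d) :
    meanSqGrad f S x ≤ 2 * (meanSqGrad f S p + L ^ 2 * ‖x - p‖ ^ 2) := by
  refine (Finset.expect_le_expect fun i _ => (hs (S i)).norm_gradient_sq_le x p).trans_eq ?_
  rw [← Finset.mul_expect, Finset.expect_add_distrib, Fintype.expect_const, meanSqGrad]

theorem expect_meanSqGrad_output_le [NeZero N] [NeZero Z] (hW : W ∈ doublyStochastic ℝ (Fin N))
    (hc : ∀ ξ, StronglyConvex μ fun x => f x ξ) (hs : ∀ ξ, Smooth L fun x => f x ξ) (hμ : 0 < μ)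
    (hα : ∀ t, IsSmallStep μ L (α t)) (x0 : Model d) (S : Dataset N Z Ξ) (k : ℕ) :
    𝔼 I : Fin k → Fin N → Fin Z, meanSqGrad f S (output f W α x0 S k I) ≤
      (2 + 6 * L ^ 2 / μ ^ 2) * meanSqGrad f S x0 :=
  calc 𝔼 I : Fin k → Fin N → Fin Z, meanSqGrad f S (output f W α x0 S k I)
      ≤ 𝔼 I : Fin k → Fin N → Fin Z, 2 * (meanSqGrad f S x0
          + L ^ 2 * 𝔼 n, ‖localModels f W α x0 S k I n - x0‖ ^ 2) :=
        Finset.expect_le_expect fun I _ => (meanSqGrad_le hs S _ x0).trans <| by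
          gcongr
          exact norm_output_sub_sq_le x0 x0 S k I
    _ = 2 * (meanSqGrad f S x0 + L ^ 2 * 𝔼 I : Fin k → Fin N → Fin Z,
          𝔼 n, ‖localModels f W α x0 S k I n - x0‖ ^ 2) := by
        rw [← Finset.mul_expect, Finset.expect_add_distrib, Fintype.expect_const,
          ← Finset.mul_expect]
    _ ≤ 2 * (meanSqGrad f S x0 + L ^ 2 * (3 / μ ^ 2 * meanSqGrad f S x0)) := by
        gcongr
        exact expect_norm_localModels_sub_sq_le hW hc hs hμ hα x0 S k
    _ = (2 + 6 * L ^ 2 / μ ^ 2) * meanSqGrad f S x0 := by ring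

theorem expect_loss_update_sub_le [NeZero N] [NeZero Z]
    (hc : ∀ ξ, StronglyConvex μ fun x => f x ξ) (hs : ∀ ξ, Smooth L fun x => f x ξ) (hμ : 0 ≤ μ)
    (hL : 0 ≤ L) {c : ℝ} (hcpos : 0 < c) (x0 : Model d) (S S' : Dataset N Z Ξ) (k : ℕ) :
    𝔼 i, 𝔼 I, (f (output f W α x0 (Function.update S i (S' i)) k I) (S i)
        - f (output f W α x0 S k I) (S i)) ≤
      c⁻¹ * 𝔼 I, meanSqGrad f S (output f W α x0 S k I) +
        (c / 4 + L) * 𝔼 i, 𝔼 I, runDist f W α x0 S (Function.update S i (S' i)) k I ^ 2 := by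
  have hpoint : ∀ i I, f (output f W α x0 (Function.update S i (S' i)) k I) (S i)
      - f (output f W α x0 S k I) (S i) ≤
      c⁻¹ * ‖∇ (fun y => f y (S i)) (output f W α x0 S k I)‖ ^ 2
        + (c / 4 + L) * runDist f W α x0 S (Function.update S i (S' i)) k I ^ 2 := fun i I =>
    (sub_le_inv_mul_norm_gradient_sq (hc (S i)) (hs (S i)) hμ hcpos _ _).trans <| by
      gcongr
      exact norm_output_sub_output_le x0 S _ k I
  refine (Finset.expect_le_expect fun i _ =>
    Finset.expect_le_expect fun I _ => hpoint i I).trans_eq ?_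
  simp_rw [Finset.expect_add_distrib, ← Finset.mul_expect, meanSqGrad]
  rw [Finset.expect_comm]

/-- The constant in the bound on the mean loss increase, at a horizon `k ≥ a μNZ`. -/
noncomputable def stabilityConst (μ L a : ℝ) : ℝ :=
  (4 + 24 * L ^ 2 / μ ^ 2) * (1 + (1 + 4 * L / μ) * (1 + 1 / (2 * a * μ)))

theorem stability_rate_le [NeZero N] [NeZero Z] (hμ : 0 < μ) (hL : 0 ≤ L) {a s : ℝ}
    (ha : 0 < a) (hs : a * (μ * N * Z) ≤ s) :
    (μ * N * Z / 4 + L) * (8 / 3 / (μ * (N * Z)) ^ 2 + 2 / ((μ * N) ^ 2 * Z) / s) ≤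
      (1 + 4 * L / μ) * (1 + 1 / (2 * a * μ)) / (μ * N * Z) := by
  have hN : (1 : ℝ) ≤ N := Nat.one_le_cast.2 NeZero.one_le
  have hZ : (1 : ℝ) ≤ Z := Nat.one_le_cast.2 NeZero.one_le
  have hNZ : (1 : ℝ) ≤ N * Z := one_le_mul_of_one_le_of_one_le hN hZ
  have hden : (μ * N) ^ 2 * Z * (a * (μ * 1 * Z)) ≤ (μ * N) ^ 2 * Z * s := by
    refine mul_le_mul_of_nonneg_left (le_trans ?_ hs) (by positivity)
    gcongr
  calc (μ * N * Z / 4 + L) * (8 / 3 / (μ * (N * Z)) ^ 2 + 2 / ((μ * N) ^ 2 * Z) / s)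
      ≤ (μ * N * Z / 4 + L * (N * Z)) *
          (4 / (μ * (N * Z)) ^ 2 + 2 / ((μ * N) ^ 2 * Z * (a * (μ * 1 * Z)))) := by
        rw [div_div _ _ s]
        have hs0 : 0 ≤ s := (by positivity : (0 : ℝ) ≤ a * (μ * N * Z)).trans hs
        gcongr
        · exact le_mul_of_one_le_right hL hNZ
        · norm_num
    _ = (1 + 4 * L / μ) * (1 + 1 / (2 * a * μ)) / (μ * N * Z) := by field_simp; ring

theorem expect_loss_update_sub_le_stabilityConst [NeZero N] [NeZero Z]
    (hW : W ∈ doublyStochastic ℝ (Fin N)) (hc : ∀ ξ, StronglyConvex μ fun x => f x ξ)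
    (hs : ∀ ξ, Smooth L fun x => f x ξ) (hμ : 0 < μ) (hL : 0 ≤ L) {k₀ : ℝ}
    (hk₀ : 2 + 4 * L ^ 2 / μ ^ 2 ≤ k₀) (x0 : Model d) (S S' : Dataset N Z Ξ) {a : ℝ}
    (ha : 0 < a) {k : ℕ} (hk : a * (μ * N * Z) ≤ k) :
    𝔼 i, 𝔼 I, (f (output f W (harmonicStep μ k₀) x0 (Function.update S i (S' i)) k I) (S i)
        - f (output f W (harmonicStep μ k₀) x0 S k I) (S i)) ≤
      stabilityConst μ L a * (meanSqGrad f S x0 + meanSqGrad f S' x0) / (μ * N * Z) := by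
  have hM : 0 < μ * N * Z := by
    have hN : (0 : ℝ) < N := Nat.cast_pos.2 (NeZero.pos N)
    have hZ : (0 : ℝ) < Z := Nat.cast_pos.2 (NeZero.pos Z)
    positivity
  have hs0 : a * (μ * N * Z) ≤ k + k₀ := by linarith [two_le_of_threshold_le hk₀]
  have hw := meanSqGrad_nonneg (f := f) S x0
  have hw' := meanSqGrad_nonneg (f := f) S' x0
  have hgrad := expect_meanSqGrad_output_le hW hc hs hμ (isSmallStep_harmonicStep hμ hk₀) x0 S k
  have hdist := expect_expect_runDist_update_sq_le hW hc hs hμ hk₀ x0 S S' k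
  have hrate := stability_rate_le hμ hL ha hs0
  set w := meanSqGrad f S x0
  set w' := meanSqGrad f S' x0
  set ρ := (4 + 24 * L ^ 2 / μ ^ 2) with hρ
  have hgrad' : (2 + 6 * L ^ 2 / μ ^ 2) * w ≤ ρ * (w + w') := by
    rw [hρ]
    gcongr
    · norm_num
    · norm_num
    · exact le_add_of_nonneg_right hw'
  refine (expect_loss_update_sub_le hc hs hμ.le hL hM x0 S S' k).trans ?_
  calc _ ≤ (μ * N * Z)⁻¹ * (ρ * (w + w')) + (μ * N * Z / 4 + L) *
          ((8 / 3 / (μ * (N * Z)) ^ 2 + 2 / ((μ * N) ^ 2 * Z) / (k + k₀)) * (ρ * (w + w'))) := by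
        gcongr
        exact hgrad.trans hgrad'
    _ ≤ (μ * N * Z)⁻¹ * (ρ * (w + w')) +
          (1 + 4 * L / μ) * (1 + 1 / (2 * a * μ)) / (μ * N * Z) * (ρ * (w + w')) := by
        rw [← mul_assoc (μ * N * Z / 4 + L)]
        gcongr
    _ = stabilityConst μ L a * (w + w') / (μ * N * Z) := by
        rw [stabilityConst]
        ring

end LossIncrease

section Minimizer

variable {d N Z : ℕ} {Ξ : Type*} {f : Model d → Ξ → ℝ} {μ L : ℝ}

theorem empLoss_eq_expect (f : Model d → Ξ → ℝ) (S : Dataset N Z Ξ) (x : Model d) :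
    empLoss f S x = 𝔼 i, f x (S i) := by
  simp only [empLoss, localLoss, expect_prod, inv_mul_sum_eq_expect]

theorem continuous_empLoss (hs : ∀ ξ, Smooth L fun x => f x ξ) (S : Dataset N Z Ξ) :
    Continuous (empLoss f S) := by
  simp only [funext (empLoss_eq_expect f S), Fintype.expect_eq_sum_div_card]
  exact (continuous_finsetSum _ fun i _ => (hs (S i)).1.continuous).div_const _

theorem quadratic_le_empLoss [NeZero N] [NeZero Z] (hc : ∀ ξ, StronglyConvex μ fun x => f x ξ)
    (S : Dataset N Z Ξ) (x : Model d) :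
    empLoss f S 0 - (𝔼 i, ‖∇ (fun y => f y (S i)) 0‖) * ‖x‖ + μ / 2 * ‖x‖ ^ 2 ≤
      empLoss f S x := by
  rw [empLoss_eq_expect, empLoss_eq_expect, Finset.expect_mul, ← Finset.expect_sub_distrib,
    ← Fintype.expect_const (ι := Fin N × Fin Z) (μ / 2 * ‖x‖ ^ 2), ← Finset.expect_add_distrib]
  refine Finset.expect_le_expect fun i _ => ?_
  have hconv := hc (S i) x 0
  have hcs := neg_le_of_abs_le (abs_real_inner_le_norm x (∇ (fun y => f y (S i)) 0))
  rw [sub_zero] at hconv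
  linarith [mul_comm ‖x‖ ‖∇ (fun y => f y (S i)) 0‖]

theorem empLoss_empMinimizer_le [NeZero N] [NeZero Z] (hμ : 0 < μ)
    (hc : ∀ ξ, StronglyConvex μ fun x => f x ξ) (hs : ∀ ξ, Smooth L fun x => f x ξ)
    (S : Dataset N Z Ξ) (y : Model d) : empLoss f S (empMinimizer f S) ≤ empLoss f S y := by
  refine Classical.epsilon_spec (p := fun x => ∀ y, empLoss f S x ≤ empLoss f S y) ?_ y
  refine (continuous_empLoss hs S).exists_forall_le' 0 ?_
  filter_upwards [(tendsto_norm_cocompact_atTop (E := Model d)).eventually_ge_atTop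
    (2 * (𝔼 i, ‖∇ (fun y => f y (S i)) 0‖) / μ)] with x hx
  have hx' := mul_le_mul_of_nonneg_right ((div_le_iff₀ hμ).1 hx) (norm_nonneg x)
  nlinarith [quadratic_le_empLoss hc S x]

theorem gradient_empLoss_empMinimizer [NeZero N] [NeZero Z] (hμ : 0 < μ)
    (hc : ∀ ξ, StronglyConvex μ fun x => f x ξ) (hs : ∀ ξ, Smooth L fun x => f x ξ)
    (S : Dataset N Z Ξ) : ∇ (empLoss f S) (empMinimizer f S) = 0 := by
  have hmin : IsLocalMin (empLoss f S) (empMinimizer f S) :=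
    Filter.Eventually.of_forall (empLoss_empMinimizer_le hμ hc hs S)
  rw [gradient, hmin.fderiv_eq_zero, map_zero]

theorem meanSqGrad_le_of_gradient_empLoss_eq_zero [NeZero N] [NeZero Z] {S : Dataset N Z Ξ}
    {p : Model d} (hp : ∇ (empLoss f S) p = 0) {σ δ : ℝ}
    (hσ : ∀ n, (Z : ℝ)⁻¹ *
      ∑ z, ‖∇ (fun y => f y (S (n, z))) p - ∇ (localLoss f S n) p‖ ^ 2 ≤ σ ^ 2)
    (hδ : (N : ℝ)⁻¹ * ∑ n, ‖∇ (localLoss f S n) p - ∇ (empLoss f S) p‖ ^ 2 ≤ δ ^ 2) :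
    meanSqGrad f S p ≤ 2 * (σ ^ 2 + δ ^ 2) := by
  simp only [inv_mul_sum_eq_expect, hp, sub_zero] at hσ hδ
  have hlocal : ∀ n, 𝔼 z, ‖∇ (fun y => f y (S (n, z))) p‖ ^ 2 ≤
      2 * (σ ^ 2 + ‖∇ (localLoss f S n) p‖ ^ 2) := fun n =>
    calc 𝔼 z, ‖∇ (fun y => f y (S (n, z))) p‖ ^ 2
        ≤ 𝔼 z, 2 * (‖∇ (fun y => f y (S (n, z))) p - ∇ (localLoss f S n) p‖ ^ 2
            + ‖∇ (localLoss f S n) p‖ ^ 2) := Finset.expect_le_expect fun z _ => by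
          simpa using norm_sub_sq_le
            (∇ (fun y => f y (S (n, z))) p - ∇ (localLoss f S n) p) (-∇ (localLoss f S n) p)
      _ ≤ 2 * (σ ^ 2 + ‖∇ (localLoss f S n) p‖ ^ 2) := by
          rw [← Finset.mul_expect, Finset.expect_add_distrib, Fintype.expect_const]
          gcongr
          exact hσ n
  rw [meanSqGrad, expect_prod]
  refine (Finset.expect_le_expect fun n _ => hlocal n).trans ?_
  rw [← Finset.mul_expect, Finset.expect_add_distrib, Fintype.expect_const]
  gcongr

theorem meanSqGrad_le_of_noise_of_heterogeneity [NeZero N] [NeZero Z] (hμ : 0 < μ)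
    (hc : ∀ ξ, StronglyConvex μ fun x => f x ξ) (hs : ∀ ξ, Smooth L fun x => f x ξ)
    {S : Dataset N Z Ξ} {σ δ : ℝ}
    (hσ : ∀ n, (Z : ℝ)⁻¹ * ∑ z, ‖∇ (fun y => f y (S (n, z))) (empMinimizer f S)
      - ∇ (localLoss f S n) (empMinimizer f S)‖ ^ 2 ≤ σ ^ 2)
    (hδ : (N : ℝ)⁻¹ * ∑ n, ‖∇ (localLoss f S n) (empMinimizer f S)
      - ∇ (empLoss f S) (empMinimizer f S)‖ ^ 2 ≤ δ ^ 2) (x : Model d) :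
    meanSqGrad f S x ≤
      4 * σ ^ 2 + 4 * δ ^ 2 + 2 * L ^ 2 * ‖x - empMinimizer f S‖ ^ 2 := by
  have hmin := meanSqGrad_le_of_gradient_empLoss_eq_zero
    (gradient_empLoss_empMinimizer hμ hc hs S) hσ hδ
  linarith [meanSqGrad_le hs S x (empMinimizer f S)]

end Minimizer

section Measurability

variable {d N Z : ℕ} {Ξ : Type*} [MeasurableSpace Ξ] {f : Model d → Ξ → ℝ} {L : ℝ}

theorem measurable_gradient_param (hf : ∀ x, Measurable (f x))
    (hd : ∀ ξ, Differentiable ℝ fun x => f x ξ) (x : Model d) :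
    Measurable fun ξ => ∇ (fun y => f y ξ) x := by
  have hdir : ∀ v : Model d, Measurable fun ξ => inner ℝ v (∇ (fun y => f y ξ) x) := by
    intro v
    refine measurable_of_tendsto_metrizable
      (f := fun (n : ℕ) ξ => (n : ℝ) • (f (x + (n : ℝ)⁻¹ • v) ξ - f x ξ))
      (fun n => ((hf _).sub (hf _)).fun_const_smul _) (tendsto_pi_nhds.2 fun ξ => ?_)
    have hlim := (((hd ξ) x).hasFDerivAt.lim_real v).comp (tendsto_natCast_atTop_atTop (R := ℝ))
    rwa [← inner_gradient_left, real_inner_comm] at hlim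
  let e := EuclideanSpace.basisFun (Fin d) ℝ
  simpa only [e.sum_repr'] using
    Finset.measurable_fun_sum Finset.univ fun j _ => (hdir (e j)).smul_const (e j)

theorem Smooth.continuous_gradient {g : Model d → ℝ} (hs : Smooth L g) : Continuous (∇ g) :=
  (LipschitzWith.of_dist_le' fun x y => by simpa only [dist_eq_norm] using hs.2 x y).continuous

theorem measurable_gradient_uncurry (hf : ∀ x, Measurable (f x))
    (hs : ∀ ξ, Smooth L fun x => f x ξ) :
    Measurable fun p : Model d × Ξ => ∇ (fun y => f y p.2) p.1 :=
  measurable_uncurry_of_continuous_of_measurable (u := fun x ξ => ∇ (fun y => f y ξ) x)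
    (fun ξ => (hs ξ).continuous_gradient) (measurable_gradient_param hf fun ξ => (hs ξ).1)

theorem measurable_loss_uncurry (hf : ∀ x, Measurable (f x))
    (hd : ∀ ξ, Differentiable ℝ fun x => f x ξ) : Measurable fun p : Model d × Ξ => f p.1 p.2 :=
  measurable_uncurry_of_continuous_of_measurable (u := f) (fun ξ => (hd ξ).continuous) hf

theorem measurable_localModels (hf : ∀ x, Measurable (f x)) (hs : ∀ ξ, Smooth L fun x => f x ξ)
    (W : Matrix (Fin N) (Fin N) ℝ) (α : ℕ → ℝ) (x0 : Model d) (k : ℕ)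
    (I : Fin k → Fin N → Fin Z) (n : Fin N) :
    Measurable fun S : Dataset N Z Ξ => localModels f W α x0 S k I n := by
  induction k generalizing n with
  | zero => exact measurable_const
  | succ k ih =>
    refine Finset.measurable_fun_sum _ fun m _ => Measurable.fun_const_smul ?_ _
    have hm := ih (fun t => I t.castSucc) m
    exact hm.sub (((measurable_gradient_uncurry hf hs).comp
      (hm.prodMk (measurable_pi_apply _))).fun_const_smul _)

theorem measurable_output (hf : ∀ x, Measurable (f x)) (hs : ∀ ξ, Smooth L fun x => f x ξ)
    (W : Matrix (Fin N) (Fin N) ℝ) (α : ℕ → ℝ) (x0 : Model d) (k : ℕ)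
    (I : Fin k → Fin N → Fin Z) :
    Measurable fun S : Dataset N Z Ξ => output f W α x0 S k I :=
  (Finset.measurable_fun_sum _ fun n _ =>
    measurable_localModels hf hs W α x0 k I n).fun_const_smul _

theorem measurable_sq_norm_gradient_eval {ι : Type*} (hf : ∀ x, Measurable (f x))
    (hd : ∀ ξ, Differentiable ℝ fun x => f x ξ) (x : Model d) (i : ι) :
    Measurable fun S : ι → Ξ => ‖∇ (fun y => f y (S i)) x‖ ^ 2 :=
  ((measurable_gradient_param hf hd x).comp (measurable_pi_apply i)).norm.pow_const 2

theorem measurable_meanSqGrad (hf : ∀ x, Measurable (f x))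
    (hd : ∀ ξ, Differentiable ℝ fun x => f x ξ) (x : Model d) :
    Measurable fun S : Dataset N Z Ξ => meanSqGrad f S x := by
  simp only [meanSqGrad, Fintype.expect_eq_sum_div_card]
  exact (Finset.measurable_fun_sum _ fun i _ =>
    measurable_sq_norm_gradient_eval hf hd x i).div_const _

end Measurability

section GhostSample

variable {ι Ξ : Type*} [Fintype ι] [DecidableEq ι] [MeasurableSpace Ξ] {D : ι → Measure Ξ}
  [∀ j, IsProbabilityMeasure (D j)]

theorem measurePreserving_exchange (D : ι → Measure Ξ) [∀ j, IsProbabilityMeasure (D j)] (i : ι) :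
    MeasurePreserving
      (fun p : (ι → Ξ) × (ι → Ξ) => (Function.update p.1 i (p.2 i), Function.update p.2 i (p.1 i)))
      ((Measure.pi D).prod (Measure.pi D)) ((Measure.pi D).prod (Measure.pi D)) := by
  have hpair := measurePreserving_arrowProdEquivProdArrow Ξ Ξ ι D D
  have hswap : MeasurePreserving
      (fun (a : ι → Ξ × Ξ) j => (if j = i then Prod.swap else id : Ξ × Ξ → Ξ × Ξ) (a j))
      (Measure.pi fun j => (D j).prod (D j)) (Measure.pi fun j => (D j).prod (D j)) := by
    refine measurePreserving_pi _ _ fun j => ?_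
    split_ifs
    · exact Measure.measurePreserving_swap
    · exact MeasurePreserving.id _
  convert (hpair.comp hswap).comp (hpair.symm _) using 1
  funext p
  refine Prod.ext (funext fun j => ?_) (funext fun j => ?_) <;>
    rcases eq_or_ne j i with rfl | hj <;>
    simp [MeasurableEquiv.arrowProdEquivProdArrow, Equiv.arrowProdEquivProdArrow, *]

variable {Φ : (ι → Ξ) → Ξ → ℝ} {i : ι}

theorem integrable_update_of_integrable_ghost
    (hghost : Integrable (fun p : (ι → Ξ) × (ι → Ξ) => Φ p.1 (p.2 i))
      ((Measure.pi D).prod (Measure.pi D))) :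
    Integrable (fun p : (ι → Ξ) × (ι → Ξ) => Φ (Function.update p.1 i (p.2 i)) (p.1 i))
      ((Measure.pi D).prod (Measure.pi D)) := by
  simpa only [Function.comp_def, Function.update_self] using
    (measurePreserving_exchange D i).integrable_comp_of_integrable hghost

theorem integral_update_eq_integral_ghost
    (hghost : Integrable (fun p : (ι → Ξ) × (ι → Ξ) => Φ p.1 (p.2 i))
      ((Measure.pi D).prod (Measure.pi D))) :
    ∫ p : (ι → Ξ) × (ι → Ξ), Φ (Function.update p.1 i (p.2 i)) (p.1 i)
        ∂(Measure.pi D).prod (Measure.pi D) =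
      ∫ p : (ι → Ξ) × (ι → Ξ), Φ p.1 (p.2 i) ∂(Measure.pi D).prod (Measure.pi D) := by
  have hex := measurePreserving_exchange D i
  have hmap := integral_map hex.measurable.aemeasurable
    (hex.map_eq.symm ▸ hghost.aestronglyMeasurable)
  rw [hex.map_eq] at hmap
  simpa only [Function.update_self] using hmap.symm

theorem integral_ghost_sub_eq
    (hself : Integrable (fun S : ι → Ξ => Φ S (S i)) (Measure.pi D))
    (hghost : Integrable (fun p : (ι → Ξ) × (ι → Ξ) => Φ p.1 (p.2 i))
      ((Measure.pi D).prod (Measure.pi D))) :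
    ∫ S, ((∫ S' : ι → Ξ, Φ S (S' i) ∂Measure.pi D) - Φ S (S i)) ∂Measure.pi D =
      ∫ p : (ι → Ξ) × (ι → Ξ), (Φ (Function.update p.1 i (p.2 i)) (p.1 i) - Φ p.1 (p.1 i))
        ∂(Measure.pi D).prod (Measure.pi D) := by
  rw [integral_sub hghost.integral_prod_left hself, ← integral_prod _ hghost,
    integral_sub (integrable_update_of_integrable_ghost hghost) (hself.comp_fst _),
    integral_update_eq_integral_ghost hghost, integral_fun_fst fun S => Φ S (S i), probReal_univ,
    one_smul]

end GhostSample

section DataLaw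

variable {d N Z : ℕ} {Ξ : Type*} [MeasurableSpace Ξ] {D : Fin N → Measure Ξ}
  [∀ n, IsProbabilityMeasure (D n)] {f : Model d → Ξ → ℝ}

instance : IsProbabilityMeasure (dataLaw Z D) :=
  inferInstanceAs (IsProbabilityMeasure (Measure.pi _))

theorem popLoss_eq_expect [NeZero Z] (hf : ∀ x, Measurable (f x)) (x : Model d) :
    popLoss f D x = 𝔼 i : Fin N × Fin Z, ∫ S, f x (S i) ∂dataLaw Z D := by
  rw [popLoss, inv_mul_sum_eq_expect, ← expect_fst (κ := Fin Z)]
  exact Finset.expect_congr rfl fun i _ => (integral_comp_eval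
    (μ := fun j : Fin N × Fin Z => D j.1) (hf x).aestronglyMeasurable).symm

end DataLaw

section OnAverageStability

variable {d N Z : ℕ} [NeZero Z] {Ξ : Type*} [MeasurableSpace Ξ] {D : Fin N → Measure Ξ}
  [∀ n, IsProbabilityMeasure (D n)] {f : Model d → Ξ → ℝ}

theorem popLoss_sub_empLoss_eq_expect (hf : ∀ x, Measurable (f x)) (S : Dataset N Z Ξ)
    (x : Model d) :
    popLoss f D x - empLoss f S x =
      𝔼 i, ((∫ S' : Dataset N Z Ξ, f x (S' i) ∂dataLaw Z D) - f x (S i)) := by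
  rw [popLoss_eq_expect (Z := Z) hf, empLoss_eq_expect, Finset.expect_sub_distrib]

theorem integrable_popLoss_sub_empLoss (hf : ∀ x, Measurable (f x)) {A : Dataset N Z Ξ → Model d}
    (hself : ∀ i, Integrable (fun S => f (A S) (S i)) (dataLaw Z D))
    (hghost : ∀ i, Integrable (fun p : Dataset N Z Ξ × Dataset N Z Ξ => f (A p.1) (p.2 i))
      ((dataLaw Z D).prod (dataLaw Z D))) :
    Integrable (fun S => popLoss f D (A S) - empLoss f S (A S)) (dataLaw Z D) := by
  simp_rw [popLoss_sub_empLoss_eq_expect hf]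
  exact integrable_expect fun i => (hghost i).integral_prod_left.sub (hself i)

theorem integral_expect_popLoss_sub_empLoss_le {J : Type*} [Fintype J]
    (hf : ∀ x, Measurable (f x)) {A : J → Dataset N Z Ξ → Model d}
    (hself : ∀ I i, Integrable (fun S => f (A I S) (S i)) (dataLaw Z D))
    (hghost : ∀ I i, Integrable (fun p : Dataset N Z Ξ × Dataset N Z Ξ => f (A I p.1) (p.2 i))
      ((dataLaw Z D).prod (dataLaw Z D))) {ε : Dataset N Z Ξ × Dataset N Z Ξ → ℝ}
    (hε : Integrable ε ((dataLaw Z D).prod (dataLaw Z D)))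
    (hstable : ∀ S S' : Dataset N Z Ξ,
      𝔼 i, 𝔼 I, (f (A I (Function.update S i (S' i))) (S i) - f (A I S) (S i)) ≤ ε (S, S')) :
    ∫ S, 𝔼 I, (popLoss f D (A I S) - empLoss f S (A I S)) ∂dataLaw Z D ≤
      ∫ p, ε p ∂(dataLaw Z D).prod (dataLaw Z D) := by
  have hincr : ∀ i I, Integrable (fun p : Dataset N Z Ξ × Dataset N Z Ξ =>
      f (A I (Function.update p.1 i (p.2 i))) (p.1 i) - f (A I p.1) (p.1 i))
      ((dataLaw Z D).prod (dataLaw Z D)) := fun i I =>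
    (integrable_update_of_integrable_ghost (Φ := fun S => f (A I S)) (hghost I i)).sub
      ((hself I i).comp_fst _)
  calc ∫ S, 𝔼 I, (popLoss f D (A I S) - empLoss f S (A I S)) ∂dataLaw Z D
      = 𝔼 i, 𝔼 I, ∫ S, ((∫ S' : Dataset N Z Ξ, f (A I S) (S' i) ∂dataLaw Z D)
          - f (A I S) (S i)) ∂dataLaw Z D := by
        rw [integral_expect fun I => integrable_popLoss_sub_empLoss hf (hself I) (hghost I),
          Finset.expect_comm]
        simp_rw [popLoss_sub_empLoss_eq_expect hf]
        exact Finset.expect_congr rfl fun I _ =>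
          integral_expect fun i => (hghost I i).integral_prod_left.sub (hself I i)
    _ = 𝔼 i, 𝔼 I, ∫ p : Dataset N Z Ξ × Dataset N Z Ξ,
          (f (A I (Function.update p.1 i (p.2 i))) (p.1 i) - f (A I p.1) (p.1 i))
            ∂(dataLaw Z D).prod (dataLaw Z D) :=
        Finset.expect_congr rfl fun i _ => Finset.expect_congr rfl fun I _ =>
          integral_ghost_sub_eq (Φ := fun S => f (A I S)) (hself I i) (hghost I i)
    _ = ∫ p : Dataset N Z Ξ × Dataset N Z Ξ, 𝔼 i, 𝔼 I,
          (f (A I (Function.update p.1 i (p.2 i))) (p.1 i) - f (A I p.1) (p.1 i))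
            ∂(dataLaw Z D).prod (dataLaw Z D) := by
        rw [integral_expect fun i => integrable_expect (hincr i)]
        simp_rw [integral_expect (hincr _)]
    _ ≤ ∫ p, ε p ∂(dataLaw Z D).prod (dataLaw Z D) :=
        integral_mono (integrable_expect fun i => integrable_expect (hincr i)) hε
          fun p => hstable p.1 p.2

end OnAverageStability

section Integrability

theorem abs_le_of_stronglyConvex_of_smooth {d : ℕ} {g : Model d → ℝ} {μ L : ℝ}
    (hc : StronglyConvex μ g) (hs : Smooth L g) (hμ : 0 ≤ μ) (hL : 0 ≤ L) (x x0 : Model d) :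
    |g x| ≤ |g x0| + ‖∇ g x0‖ ^ 2 + (1 + L) * ‖x - x0‖ ^ 2 := by
  have hdiff := abs_sub_le_norm_gradient_mul hc hs hμ hL x0 x
  have habs := abs_sub_abs_le_abs_sub (g x) (g x0)
  nlinarith [two_mul_le_add_sq ‖∇ g x0‖ ‖x - x0‖, sq_nonneg ‖∇ g x0‖, sq_nonneg ‖x - x0‖]

variable {d N Z : ℕ} {Ξ : Type*} [MeasurableSpace Ξ] {f : Model d → Ξ → ℝ} {μ L : ℝ} {x0 : Model d}

theorem integrable_loss_comp {Ω : Type*} [MeasurableSpace Ω] {P : Measure Ω} {X : Ω → Model d}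
    {ξ : Ω → Ξ} (hf : ∀ x, Measurable (f x)) (hc : ∀ ξ, StronglyConvex μ fun x => f x ξ)
    (hs : ∀ ξ, Smooth L fun x => f x ξ) (hμ : 0 ≤ μ) (hL : 0 ≤ L) (hX : Measurable X)
    (hξ : Measurable ξ) (hloss : Integrable (fun ω => f x0 (ξ ω)) P)
    (hgrad : Integrable (fun ω => ‖∇ (fun y => f y (ξ ω)) x0‖ ^ 2) P)
    (hdist : Integrable (fun ω => ‖X ω - x0‖ ^ 2) P) :
    Integrable (fun ω => f (X ω) (ξ ω)) P :=
  ((hloss.abs.add hgrad).add (hdist.const_mul (1 + L))).mono'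
    ((measurable_loss_uncurry hf fun ξ => (hs ξ).1).comp (hX.prodMk hξ)).aestronglyMeasurable
    (ae_of_all _ fun ω =>
      abs_le_of_stronglyConvex_of_smooth (hc (ξ ω)) (hs (ξ ω)) hμ hL (X ω) x0)

variable {D : Fin N → Measure Ξ}

theorem integrable_norm_gradient_sq (hf : ∀ x, Measurable (f x))
    (hd : ∀ ξ, Differentiable ℝ fun x => f x ξ)
    (hw : Integrable (fun S : Dataset N Z Ξ => meanSqGrad f S x0) (dataLaw Z D))
    (i : Fin N × Fin Z) :
    Integrable (fun S : Dataset N Z Ξ => ‖∇ (fun y => f y (S i)) x0‖ ^ 2) (dataLaw Z D) := by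
  refine (hw.const_mul (Fintype.card (Fin N × Fin Z) : ℝ)).mono'
    (measurable_sq_norm_gradient_eval hf hd x0 i).aestronglyMeasurable (ae_of_all _ fun S => ?_)
  rw [Real.norm_of_nonneg (sq_nonneg _)]
  exact le_card_mul_expect (g := fun i => ‖∇ (fun y => f y (S i)) x0‖ ^ 2)
    (fun _ => sq_nonneg _) i

theorem integrable_norm_output_sub_sq [NeZero N] [NeZero Z] {W : Matrix (Fin N) (Fin N) ℝ}
    {α : ℕ → ℝ} (hW : W ∈ doublyStochastic ℝ (Fin N)) (hf : ∀ x, Measurable (f x))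
    (hc : ∀ ξ, StronglyConvex μ fun x => f x ξ) (hs : ∀ ξ, Smooth L fun x => f x ξ) (hμ : 0 < μ)
    (hα : ∀ t, IsSmallStep μ L (α t))
    (hw : Integrable (fun S : Dataset N Z Ξ => meanSqGrad f S x0) (dataLaw Z D))
    {k : ℕ} (I : Fin k → Fin N → Fin Z) :
    Integrable (fun S : Dataset N Z Ξ => ‖output f W α x0 S k I - x0‖ ^ 2) (dataLaw Z D) := by
  refine ((hw.const_mul (3 / μ ^ 2)).const_mul (Fintype.card (Fin k → Fin N → Fin Z) : ℝ)).mono'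
    (((measurable_output hf hs W α x0 k I).sub_const x0).norm.pow_const 2).aestronglyMeasurable
    (ae_of_all _ fun S => ?_)
  rw [Real.norm_of_nonneg (sq_nonneg _)]
  refine (le_card_mul_expect (g := fun I => ‖output f W α x0 S k I - x0‖ ^ 2)
    (fun _ => sq_nonneg _) I).trans (mul_le_mul_of_nonneg_left ?_ (Nat.cast_nonneg _))
  exact (Finset.expect_le_expect fun I _ => norm_output_sub_sq_le x0 x0 S k I).trans
    (expect_norm_localModels_sub_sq_le hW hc hs hμ hα x0 S k)

variable [∀ n, IsProbabilityMeasure (D n)]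

theorem integrable_loss_eval (hfD : ∀ n, Integrable (f x0) (D n)) (i : Fin N × Fin Z) :
    Integrable (fun S : Dataset N Z Ξ => f x0 (S i)) (dataLaw Z D) :=
  integrable_comp_eval (μ := fun j : Fin N × Fin Z => D j.1) (hfD i.1)

variable {A : Dataset N Z Ξ → Model d}

theorem integrable_loss_self (hf : ∀ x, Measurable (f x)) (hfD : ∀ n, Integrable (f x0) (D n))
    (hc : ∀ ξ, StronglyConvex μ fun x => f x ξ) (hs : ∀ ξ, Smooth L fun x => f x ξ) (hμ : 0 ≤ μ)
    (hL : 0 ≤ L) (hw : Integrable (fun S : Dataset N Z Ξ => meanSqGrad f S x0) (dataLaw Z D))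
    (hA : Measurable A) (hdist : Integrable (fun S => ‖A S - x0‖ ^ 2) (dataLaw Z D))
    (i : Fin N × Fin Z) : Integrable (fun S => f (A S) (S i)) (dataLaw Z D) :=
  integrable_loss_comp hf hc hs hμ hL hA (measurable_pi_apply i) (integrable_loss_eval hfD i)
    (integrable_norm_gradient_sq hf (fun ξ => (hs ξ).1) hw i) hdist

theorem integrable_loss_ghost (hf : ∀ x, Measurable (f x)) (hfD : ∀ n, Integrable (f x0) (D n))
    (hc : ∀ ξ, StronglyConvex μ fun x => f x ξ) (hs : ∀ ξ, Smooth L fun x => f x ξ) (hμ : 0 ≤ μ)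
    (hL : 0 ≤ L) (hw : Integrable (fun S : Dataset N Z Ξ => meanSqGrad f S x0) (dataLaw Z D))
    (hA : Measurable A) (hdist : Integrable (fun S => ‖A S - x0‖ ^ 2) (dataLaw Z D))
    (i : Fin N × Fin Z) :
    Integrable (fun p : Dataset N Z Ξ × Dataset N Z Ξ => f (A p.1) (p.2 i))
      ((dataLaw Z D).prod (dataLaw Z D)) :=
  integrable_loss_comp hf hc hs hμ hL (hA.comp measurable_fst)
    ((measurable_pi_apply i).comp measurable_snd)
    ((integrable_loss_eval hfD i).comp_snd (dataLaw Z D))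
    ((integrable_norm_gradient_sq hf (fun ξ => (hs ξ).1) hw i).comp_snd (dataLaw Z D))
    (hdist.comp_fst (dataLaw Z D))

end Integrability

section InitialGradient

variable {d N Z : ℕ} [NeZero N] [NeZero Z] {Ξ : Type*} [MeasurableSpace Ξ]
  {D : Fin N → Measure Ξ} [∀ n, IsProbabilityMeasure (D n)] {f : Model d → Ξ → ℝ} {μ L σ δ : ℝ}
  {x0 : Model d}

theorem integrable_meanSqGrad_and_integral_le (hμ : 0 < μ) (hf : ∀ x, Measurable (f x))
    (hc : ∀ ξ, StronglyConvex μ fun x => f x ξ) (hs : ∀ ξ, Smooth L fun x => f x ξ)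
    (hσ : ∀ᵐ S ∂dataLaw Z D, ∀ n, (Z : ℝ)⁻¹ *
      ∑ z, ‖∇ (fun y => f y (S (n, z))) (empMinimizer f S)
        - ∇ (localLoss f S n) (empMinimizer f S)‖ ^ 2 ≤ σ ^ 2)
    (hδ : ∀ᵐ S ∂dataLaw Z D, (N : ℝ)⁻¹ * ∑ n, ‖∇ (localLoss f S n) (empMinimizer f S)
      - ∇ (empLoss f S) (empMinimizer f S)‖ ^ 2 ≤ δ ^ 2)
    (h0 : Integrable (fun S => ‖x0 - empMinimizer f S‖ ^ 2) (dataLaw Z D)) :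
    Integrable (fun S => meanSqGrad f S x0) (dataLaw Z D) ∧
    ∫ S, meanSqGrad f S x0 ∂dataLaw Z D ≤
      4 * σ ^ 2 + 4 * δ ^ 2 + 2 * L ^ 2 * ∫ S, ‖x0 - empMinimizer f S‖ ^ 2 ∂dataLaw Z D := by
  have hbound : ∀ᵐ S ∂dataLaw Z D, meanSqGrad f S x0 ≤
      4 * σ ^ 2 + 4 * δ ^ 2 + 2 * L ^ 2 * ‖x0 - empMinimizer f S‖ ^ 2 := by
    filter_upwards [hσ, hδ] with S hσS hδS
    exact meanSqGrad_le_of_noise_of_heterogeneity hμ hc hs hσS hδS x0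
  have hdom := (integrable_const (4 * σ ^ 2 + 4 * δ ^ 2)).add (h0.const_mul (2 * L ^ 2))
  have hint : Integrable (fun S => meanSqGrad f S x0) (dataLaw Z D) :=
    hdom.mono' (measurable_meanSqGrad hf (fun ξ => (hs ξ).1) x0).aestronglyMeasurable <|
      hbound.mono fun S hS => by rwa [Real.norm_of_nonneg (meanSqGrad_nonneg S x0)]
  refine ⟨hint, (integral_mono_ae hint hdom hbound).trans_eq ?_⟩
  simp only [Pi.add_apply]
  rw [integral_add (integrable_const _) (h0.const_mul _), integral_const, integral_const_mul,
    probReal_univ, one_smul]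

end InitialGradient

section Generalization

variable {d N Z : ℕ} [NeZero N] [NeZero Z] {Ξ : Type*} [MeasurableSpace Ξ]
  {D : Fin N → Measure Ξ} [∀ n, IsProbabilityMeasure (D n)] {f : Model d → Ξ → ℝ}
  {W : Matrix (Fin N) (Fin N) ℝ} {μ L : ℝ} {x0 : Model d} {k : ℕ}

theorem integrable_genGap_and_genError_le (hW : W ∈ doublyStochastic ℝ (Fin N))
    (hf : ∀ x, Measurable (f x)) (hfD : ∀ n, Integrable (f x0) (D n))
    (hc : ∀ ξ, StronglyConvex μ fun x => f x ξ) (hs : ∀ ξ, Smooth L fun x => f x ξ) (hμ : 0 < μ)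
    (hL : 0 ≤ L) {k₀ : ℝ} (hk₀ : 2 + 4 * L ^ 2 / μ ^ 2 ≤ k₀)
    (hw : Integrable (fun S : Dataset N Z Ξ => meanSqGrad f S x0) (dataLaw Z D)) {a : ℝ}
    (ha : 0 < a) (hk : a * (μ * N * Z) ≤ k) :
    (∀ I, Integrable (fun S => genGap f D W (harmonicStep μ k₀) x0 k S I) (dataLaw Z D)) ∧
    genError Z f D W (harmonicStep μ k₀) x0 k ≤
      stabilityConst μ L a * (2 * ∫ S, meanSqGrad f S x0 ∂dataLaw Z D) / (μ * N * Z) := by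
  have hA : ∀ I : Fin k → Fin N → Fin Z, Measurable
      fun S : Dataset N Z Ξ => output f W (harmonicStep μ k₀) x0 S k I :=
    measurable_output hf hs W _ x0 k
  have hdist := integrable_norm_output_sub_sq hW hf hc hs hμ (isSmallStep_harmonicStep hμ hk₀)
    hw (k := k)
  have hself := fun I => integrable_loss_self hf hfD hc hs hμ.le hL hw (hA I) (hdist I)
  have hghost := fun I => integrable_loss_ghost hf hfD hc hs hμ.le hL hw (hA I) (hdist I)
  refine ⟨fun I => integrable_popLoss_sub_empLoss hf (hself I) (hghost I), ?_⟩
  have hw₁ := hw.comp_fst (dataLaw Z D)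
  have hw₂ := hw.comp_snd (dataLaw Z D)
  refine (integral_expect_popLoss_sub_empLoss_le hf hself hghost
    (((hw₁.add hw₂).const_mul (stabilityConst μ L a)).div_const (μ * N * Z)) fun S S' =>
      expect_loss_update_sub_le_stabilityConst hW hc hs hμ hL hk₀ x0 S S' ha hk).trans_eq ?_
  rw [integral_div, integral_const_mul]
  simp only [Pi.add_apply]
  rw [integral_add hw₁ hw₂, integral_fun_fst fun S => meanSqGrad f S x0,
    integral_fun_snd fun S => meanSqGrad f S x0, probReal_univ, one_smul, two_mul]

theorem stabilityConst_le (hL : 0 < L) (hμ : 0 < μ) {a k₀ : ℝ} (ha : 0 < a)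
    (hk₀ : 2 + 4 * L ^ 2 / μ ^ 2 ≤ k₀) :
    stabilityConst μ L a ≤ (4 + 24 * k₀) * (1 + (1 + 4 * k₀) * (1 + k₀ / (2 * a * L))) := by
  have hsq : L ^ 2 / μ ^ 2 ≤ k₀ := by
    have : 0 ≤ L ^ 2 / μ ^ 2 := by positivity
    linarith [mul_div_assoc 4 (L ^ 2) (μ ^ 2)]
  have hratio : L / μ ≤ k₀ := by
    have := two_mul_le_add_sq (L / μ) 1
    rw [div_pow] at this
    linarith [mul_div_assoc 4 (L ^ 2) (μ ^ 2), div_nonneg (sq_nonneg L) (sq_nonneg μ)]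
  have hpos : 0 ≤ k₀ := (div_nonneg hL.le hμ.le).trans hratio
  have hinv : 1 / (2 * a * μ) ≤ k₀ / (2 * a * L) := by
    rw [show 1 / (2 * a * μ) = L / μ / (2 * a * L) by field_simp]
    gcongr
  rw [stabilityConst, mul_div_assoc, mul_div_assoc]
  gcongr

end Generalization

end DSGD

theorem theorem3_general (L : ℝ) (hL : 0 < L) :
    ∃ κ : ℝ → ℝ, ∀ k₀ a : ℝ, 0 < a →
    ∃ C : ℝ, 0 < C ∧
    ∀ μ : ℝ, 0 < μ → κ μ ≤ k₀ →
    ∀ N Z d : ℕ, 0 < N → 0 < Z →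
    ∀ (Ξ : Type*) [MeasurableSpace Ξ] (D : Fin N → Measure Ξ) [∀ n, IsProbabilityMeasure (D n)]
      (W : Matrix (Fin N) (Fin N) ℝ) (f : DSGD.Model d → Ξ → ℝ) (x0 : DSGD.Model d)
      (σ δ : ℝ) (k : ℕ),
    W ∈ doublyStochastic ℝ (Fin N) →
    (∀ x, Measurable (f x)) → (∀ n, Integrable (f x0) (D n)) →
    (∀ ξ, DSGD.StronglyConvex μ fun x => f x ξ) →
    (∀ ξ, DSGD.Smooth L fun x => f x ξ) →
    (∀ᵐ S ∂(DSGD.dataLaw Z D), ∀ n, (Z : ℝ)⁻¹ *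
      ∑ z, ‖∇ (fun y => f y (S (n, z))) (DSGD.empMinimizer f S)
        - ∇ (DSGD.localLoss f S n) (DSGD.empMinimizer f S)‖ ^ 2 ≤ σ ^ 2) →
    (∀ᵐ S ∂(DSGD.dataLaw Z D), (N : ℝ)⁻¹ *
      ∑ n, ‖∇ (DSGD.localLoss f S n) (DSGD.empMinimizer f S)
        - ∇ (DSGD.empLoss f S) (DSGD.empMinimizer f S)‖ ^ 2 ≤ δ ^ 2) →
    Integrable (fun S => ‖x0 - DSGD.empMinimizer f S‖ ^ 2) (DSGD.dataLaw Z D) →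
    a * (μ * N * Z) ≤ k →
    (∀ I, Integrable
      (fun S => DSGD.genGap f D W (fun t => 1 / (μ * (t + k₀))) x0 k S I) (DSGD.dataLaw Z D)) ∧
    DSGD.genError Z f D W (fun t => 1 / (μ * (t + k₀))) x0 k ≤
      C * (∫ S, ‖x0 - DSGD.empMinimizer f S‖ ^ 2 ∂(DSGD.dataLaw Z D)) / (μ * N * Z)
      + C * σ ^ 2 / (μ * N * Z)
      + C * δ ^ 2 / (μ * N * Z) := by
  refine ⟨fun μ => 2 + 4 * L ^ 2 / μ ^ 2, fun k₀ a ha =>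
    ⟨(4 + 24 * |k₀|) * (1 + (1 + 4 * |k₀|) * (1 + |k₀| / (2 * a * L))) * (8 + 4 * L ^ 2),
      by positivity, ?_⟩⟩
  intro μ hμ hκ N Z d hN hZ Ξ _ D _ W f x0 σ δ k hW hf hfD hc hs hσ hδ h0 hk
  have : NeZero N := ⟨hN.ne'⟩
  have : NeZero Z := ⟨hZ.ne'⟩
  obtain ⟨hw, hw_le⟩ := DSGD.integrable_meanSqGrad_and_integral_le hμ hf hc hs hσ hδ h0
  obtain ⟨hgap, herr⟩ :=
    DSGD.integrable_genGap_and_genError_le hW hf hfD hc hs hμ hL.le hκ hw ha hk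
  have hK := DSGD.stabilityConst_le hL hμ ha (hκ.trans (le_abs_self k₀))
  have hw0 : 0 ≤ ∫ S, DSGD.meanSqGrad f S x0 ∂(DSGD.dataLaw Z D) :=
    integral_nonneg fun S => DSGD.meanSqGrad_nonneg S x0
  have hE0 : 0 ≤ ∫ S, ‖x0 - DSGD.empMinimizer f S‖ ^ 2 ∂(DSGD.dataLaw Z D) :=
    integral_nonneg fun S => sq_nonneg _
  refine ⟨hgap, herr.trans ?_⟩
  rw [← add_div, ← add_div, ← mul_add, ← mul_add, mul_assoc _ (8 + 4 * L ^ 2)]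
  gcongr ?_ * ?_ / _
  nlinarith [mul_nonneg (sq_nonneg L) (add_nonneg (sq_nonneg σ) (sq_nonneg δ))]

theorem theorem3 (L lam : ℝ) (hL : 0 < L) (hlam : 0 < lam) :
    -- `κ` says how large `k₀` must be; it depends on `μ`, `L` and `λ` only
    ∃ κ : ℝ → ℝ, ∀ (k₀ a b : ℝ), 0 < a →
    -- the constant of the bound depends on `L`, `λ`, `k₀` and the constants in `k ≍ μNZ` only
    ∃ C : ℝ, 0 < C ∧
    ∀ (μ : ℝ), 0 < μ → 0 < k₀ → κ μ ≤ k₀ →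
    ∀ (N Z d : ℕ), 0 < N → 0 < Z →
    ∀ (Ξ : Type*) [MeasurableSpace Ξ] (D : Fin N → Measure Ξ) [∀ n, IsProbabilityMeasure (D n)]
      (G : SimpleGraph (Fin N)) (W : Matrix (Fin N) (Fin N) ℝ)
      (f : DSGD.Model d → Ξ → ℝ) (x0 : DSGD.Model d) (σ δ : ℝ) (k : ℕ),
    -- the network
    G.Connected → DSGD.IsMixingMatrix G W → DSGD.spectralGap W = lam →
    -- the loss
    (∀ x, Measurable (f x)) → (∀ n x, Integrable (f x) (D n)) →
    (∀ ξ, DSGD.StronglyConvex μ fun x => f x ξ) →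
    (∀ ξ, DSGD.Smooth L fun x => f x ξ) →
    -- the data
    (∀ᵐ S ∂(DSGD.dataLaw Z D), DSGD.NoiseBound f S σ) →
    (∀ᵐ S ∂(DSGD.dataLaw Z D), DSGD.HeterogeneityBound f S δ) →
    Integrable (fun S => ‖x0 - DSGD.empMinimizer f S‖ ^ 2) (DSGD.dataLaw Z D) →
    -- the horizon
    a * (μ * N * Z) ≤ k → k ≤ b * (μ * N * Z) →
    (∀ I, Integrable
      (fun S => DSGD.genGap f D W (fun t => 1 / (μ * (t + k₀))) x0 k S I) (DSGD.dataLaw Z D)) ∧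
    DSGD.genError Z f D W (fun t => 1 / (μ * (t + k₀))) x0 k ≤
      C * (∫ S, ‖x0 - DSGD.empMinimizer f S‖ ^ 2 ∂(DSGD.dataLaw Z D)) / (μ * N * Z)
      + C * (σ ^ 2 * (1 + Real.log (N * Z))) / (μ * N * Z)
      + C * δ ^ 2 / (μ * N * Z) := by
  obtain ⟨κ, h⟩ := theorem3_general L hL
  refine ⟨κ, fun k₀ a b ha => (h k₀ a ha).imp fun C ⟨hC, h⟩ => ⟨hC, ?_⟩⟩
  intro μ hμ _ hκ N Z d hN hZ Ξ _ D _ G W f x0 σ δ k _ hW _ hf hfD hc hs hσ hδ h0 hk _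
  have hlog : 0 ≤ Real.log (N * Z) := mod_cast Real.log_natCast_nonneg (N * Z)
  refine (h μ hμ hκ N Z d hN hZ Ξ D W f x0 σ δ k hW.mem_doublyStochastic hf (fun n => hfD n x0)
    hc hs (hσ.mono fun S hS => hS _) (hδ.mono fun S hS => hS _) h0 hk).imp_right
    fun herr => herr.trans ?_
  gcongr
  exact le_mul_of_one_le_right (sq_nonneg σ) (le_add_of_nonneg_right hlog)
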